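/- Partial fixed-point logic with counting (PFPC) over a signature $\tau$ of relation and constant symbols has element variables, ranging over the universe of a finite nonempty structure, number variables, ranging over $\{0,\dots,n\}$ where $n$ is the size of the structure, and relation variables, each with a type in $\{\mathrm{elem},\mathrm{num}\}^m$ for some $m$. Element terms are element variables and constant symbols. Number terms are number variables and counting terms $\#x\,\varphi$, with $x$ an element variable, denoting the number of elements satisfying $\varphi$. Formulas are built from equalities of terms of the same sort, inequalities $s\le t$ of number terms, and relation symbols and relation variables applied to terms of the appropriate sorts, using $\neg,\land,\lor$, the quantifiers $\forall,\exists$ over both sorts, and the partial fixed-point operator $[\mathbf{pfp}_{R,\vec x}\,\varphi](\vec t)$. The last asserts that the value of $\vec t$ lies in the partial fixed point of $F(S)=\{\vec a : \varphi[S/R,\vec a/\vec x]\}$, which is the limit of the sequence $\emptyset, F(\emptyset), F(F(\emptyset)),\dots$ if this sequence is eventually constant, and $\emptyset$ otherwise. The spectrum of a finite simple undirected graph is the multiset of roots, with multiplicity, of the characteristic polynomial of its adjacency matrix. A finite graph $G$ is determined by its spectrum if every finite graph with the same spectrum is isomorphic to $G$. Theorem. (1) The class of graphs determined by their spectrum is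 definable in PFPC: there is a single sentence $\varphi$ of PFPC over the signature $\{E\}$, with $E$ binary, such that for every finite nonempty graph $G$, $G\models\varphi$ if and only if $G$ is determined by its spectrum. (2) PFPC can express second-order quantification over binary relations on the number domain: for every signature $\tau$, every PFPC formula $\theta$ over $\tau$ and every relation variable $R$ of type $(\mathrm{num},\mathrm{num})$ there is a PFPC formula $\psi$ over $\tau$, whose free variables are among those of $\theta$ other than $R$, such that on every finite nonempty $\tau$-structure and under every assignment to the free variables, $\psi$ holds if and only if $\theta$ holds for every binary relation $R$ on the number domain. -/

import Mathlib

/-! ## Partial fixed-point logic with counting -/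

namespace PFPC

/-- The two sorts of the logic: elements of the structure, and numbers. -/
inductive Srt : Type
  | elem
  | num
  deriving DecidableEq

/-- First-order variables: a sort and a name. -/
abbrev FOVar : Type := Srt × ℕ

/-- Relation variables: a type, i.e. an element of `{elem, num}^m` for some `m`, and a name. -/
abbrev RelVar : Type := List Srt × ℕ

mutual

/-- Terms of each sort. Element terms are element variables and constant symbols, number terms are
number variables and counting terms `# x φ` where `x` is an element variable. -/
inductive Term (L : FirstOrder.Language.{0, 0}) : Srt → Type
  | var (s : Srt) (x : ℕ) : Term L s
  | const (c : L.Constants) : Term L Srt.elem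
  | count (x : ℕ) (φ : Formula L) : Term L Srt.num

/-- Tuples of terms of a given type. -/
inductive Args (L : FirstOrder.Language.{0, 0}) : List Srt → Type
  | nil : Args L []
  | cons {s : Srt} {σ : List Srt} (t : Term L s) (ts : Args L σ) : Args L (s :: σ)

/-- Formulas of partial fixed-point logic with counting over the constant and relation symbols
of `L`. -/
inductive Formula (L : FirstOrder.Language.{0, 0}) : Type
  | eq {s : Srt} (t u : Term L s) : Formula L
  | le (t u : Term L Srt.num) : Formula L
  | rel {m : ℕ} (R : L.Relations m) (ts : Fin m → Term L Srt.elem) : Formula L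
  | relVar (X : RelVar) (ts : Args L X.1) : Formula L
  | neg (φ : Formula L) : Formula L
  | and (φ ψ : Formula L) : Formula L
  | or (φ ψ : Formula L) : Formula L
  | all (x : FOVar) (φ : Formula L) : Formula L
  | ex (x : FOVar) (φ : Formula L) : Formula L
  /-- The formula `[pfp_{X, xs} φ](ts)`. The relation variable `X` is the one with name `X`
  whose type is the sequence of the sorts of the distinct variables `xs`. -/
  | pfp (X : ℕ) (xs : List FOVar) (hxs : xs.Nodup) (φ : Formula L)
      (ts : Args L (xs.map Prod.fst)) : Formula L

end

/-! ### Free variables -/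

mutual

/-- The free variables (first-order and relational) of a term. -/
def Term.fv {L : FirstOrder.Language.{0, 0}} : {s : Srt} → Term L s → Finset (FOVar ⊕ RelVar)
  | s, .var _ x => {Sum.inl (s, x)}
  | _, .const _ => ∅
  | _, .count x φ => φ.fv \ {Sum.inl (Srt.elem, x)}

/-- The free variables of a tuple of terms. -/
def Args.fv {L : FirstOrder.Language.{0, 0}} : {σ : List Srt} → Args L σ → Finset (FOVar ⊕ RelVar)
  | _, .nil => ∅
  | _, .cons t ts => t.fv ∪ ts.fv

/-- The free variables of a formula. -/
def Formula.fv {L : FirstOrder.Language.{0, 0}} : Formula L → Finset (FOVar ⊕ RelVar)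
  | .eq t u => t.fv ∪ u.fv
  | .le t u => t.fv ∪ u.fv
  | .rel _ ts => Finset.univ.biUnion fun i => (ts i).fv
  | .relVar X ts => {Sum.inr X} ∪ ts.fv
  | .neg φ => φ.fv
  | .and φ ψ => φ.fv ∪ ψ.fv
  | .or φ ψ => φ.fv ∪ ψ.fv
  | .all x φ => φ.fv \ {Sum.inl x}
  | .ex x φ => φ.fv \ {Sum.inl x}
  | .pfp X xs _ φ ts =>
      (φ.fv \ ((xs.map Sum.inl).toFinset ∪ {Sum.inr (xs.map Prod.fst, X)})) ∪ ts.fv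

end

/-- A sentence is a formula without free variables of either kind. -/
def Formula.IsSentence {L : FirstOrder.Language.{0, 0}} (φ : Formula L) : Prop := φ.fv = ∅

/-! ### Semantics -/

/-- The domains of the two sorts: the universe `V`, and the numbers `0, …, |V|`. -/
def Dom (V : Type) : Srt → Type
  | Srt.elem => V
  | Srt.num => Fin (Nat.card V + 1)

/-- Tuples of values of a given type. -/
def Tuple (V : Type) : List Srt → Type
  | [] => Unit
  | s :: σ => Dom V s × Tuple V σ

/-- Assignments of values to the first-order variables and of relations to the relation
variables. -/
structure Assignment (V : Type) : Type where
  fo : (x : FOVar) → Dom V x.1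
  rel : (X : RelVar) → Set (Tuple V X.1)

/-- `ρ[x := a]` -/
def Assignment.set {V : Type} (ρ : Assignment V) (x : FOVar) (a : Dom V x.1) : Assignment V :=
  { ρ with fo := Function.update ρ.fo x a }

/-- `ρ[X := S]` -/
def Assignment.setRel {V : Type} (ρ : Assignment V) (X : RelVar) (S : Set (Tuple V X.1)) :
    Assignment V :=
  { ρ with rel := Function.update ρ.rel X S }

/-- `ρ[xs := as]` -/
def Assignment.setTuple {V : Type} (ρ : Assignment V) :
    (xs : List FOVar) → Tuple V (xs.map Prod.fst) → Assignment V
  | [], _ => ρ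
  | x :: xs, as => (ρ.set x as.1).setTuple xs as.2

/-- The number of elements with property `P`, as an element of the number domain. -/
noncomputable def countVal {V : Type} [Finite V] (P : V → Prop) : Dom V Srt.num :=
  (⟨Nat.card {a : V // P a}, Nat.lt_succ_of_le (Finite.card_subtype_le P)⟩ :
    Fin (Nat.card V + 1))

/-- The partial fixed point of `F`: if the sequence `∅, F ∅, F (F ∅), …` becomes stationary, the
value at which it does so, and otherwise the empty set. -/
def partialFix {α : Type} (F : Set α → Set α) : Set α :=
  {a | ∃ i : ℕ, F (F^[i] ∅) = F^[i] ∅ ∧ a ∈ F^[i] ∅}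

mutual

/-- The value of a term. -/
noncomputable def Term.eval {L : FirstOrder.Language.{0, 0}} {V : Type} [L.Structure V] [Finite V] :
    {s : Srt} → Term L s → Assignment V → Dom V s
  | s, .var _ x, ρ => ρ.fo (s, x)
  | _, .const c, _ => ((c : V) : Dom V Srt.elem)
  | _, .count x φ, ρ => countVal fun a : V => φ.Sat (ρ.set (Srt.elem, x) a)

/-- The value of a tuple of terms. -/
noncomputable def Args.eval {L : FirstOrder.Language.{0, 0}} {V : Type} [L.Structure V] [Finite V] :
    {σ : List Srt} → Args L σ → Assignment V → Tuple V σ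
  | _, .nil, _ => ()
  | _, .cons t ts, ρ => (t.eval ρ, ts.eval ρ)

/-- `φ.Sat ρ`: the formula `φ` holds in the structure `V` under the assignment `ρ`. -/
noncomputable def Formula.Sat {L : FirstOrder.Language.{0, 0}} {V : Type} [L.Structure V] [Finite V] :
    Formula L → Assignment V → Prop
  | .eq t u, ρ => t.eval ρ = u.eval ρ
  | .le t u, ρ => (show Fin (Nat.card V + 1) from t.eval ρ) ≤ u.eval ρ
  | .rel R ts, ρ => FirstOrder.Language.Structure.RelMap (M := V) R fun i => (ts i).eval ρ
  | .relVar X ts, ρ => ts.eval ρ ∈ ρ.rel X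
  | .neg φ, ρ => ¬ φ.Sat ρ
  | .and φ ψ, ρ => φ.Sat ρ ∧ ψ.Sat ρ
  | .or φ ψ, ρ => φ.Sat ρ ∨ ψ.Sat ρ
  | .all x φ, ρ => ∀ a : Dom V x.1, φ.Sat (ρ.set x a)
  | .ex x φ, ρ => ∃ a : Dom V x.1, φ.Sat (ρ.set x a)
  | .pfp X xs _ φ ts, ρ =>
      ts.eval ρ ∈ partialFix fun S : Set (Tuple V (xs.map Prod.fst)) =>
        {as | φ.Sat ((ρ.setRel (xs.map Prod.fst, X) S).setTuple xs as)}

end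

/-- A graph, as a structure with one binary relation symbol, is a model of `φ`. -/
def Models {V : Type} [Finite V] (G : SimpleGraph V) (φ : Formula FirstOrder.Language.graph) : Prop :=
  letI := G.structure
  ∀ ρ : Assignment V, φ.Sat ρ

end PFPC

/-! ## Graphs determined by their spectrum -/

namespace GraphSpectrum

open Classical in
/-- The spectrum of a finite graph: the roots, with multiplicity, of the characteristic polynomial
of its adjacency matrix. -/
noncomputable def spec {V : Type} [Fintype V] (G : SimpleGraph V) : Multiset ℝ :=
  (G.adjMatrix ℝ).charpoly.roots

/-- `G` is determined by its spectrum: every finite graph with the same spectrum is isomorphic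
to `G`. -/
def IsDS {V : Type} [Fintype V] (G : SimpleGraph V) : Prop :=
  ∀ (W : Type) [Fintype W] (H : SimpleGraph W), spec G = spec H → Nonempty (G ≃g H)

end GraphSpectrum

/-!
# Graphs determined by their spectrum in partial fixed-point logic with counting

**Quantification over binary relations on numbers.** The pairs of numbers are linearly ordered
lexicographically, so a binary relation `R` on the number domain is a binary number, and adding `1`
to it is expressible by a first-order formula. A partial fixed point that adds `1` to `R` as long as
`θ` holds of `R` runs through all relations, starting with `∅`. It is stationary exactly at the first
relation that violates `θ`; if there is none, the counter cycles forever and the partial fixed point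
is empty by convention. Together with a separate test of `θ` at `∅`, this expresses that `θ` holds
for all `R` (`partialFix_binSucc_eq_empty_iff`, `exists_allNumRel`).

**Graphs determined by their spectrum.** No formula of the logic can tell in general whether an
unordered graph `G` is isomorphic to a graph on the numbers. But `G` is determined by its spectrum if
and only if any two graphs on the numbers less than `n = |G|` with the same spectrum as `G` are
isomorphic to each other (`isDS_iff`), since `G` itself is isomorphic to one of them. Graphs on the
numbers, and isomorphisms between them, are binary relations on the number domain, over which
quantification is possible by the first part.

It remains to express that the spectra are equal. The spectral theorem and Newton's identities show
that this holds if and only if the traces of the `k`-th powers of the adjacency matrices are equal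
for all `k ≤ n` (`spec_eq_spec_iff`). Those traces are less than `2 ^ ((n + 1) ^ 2)`, so they can
be handled in binary, with pairs of numbers as positions of digits. The entries of the powers are
defined by recursion on the exponent (`DefP.testBit_pow`). The recursion needs sums of `n` large
numbers indexed by unordered vertices (`DefP.testBit_sum`): the number of summands with digit `1` at
a given position is a counting term, and the carries, which are at most `n`, are defined by recursion
on the position. All recursions are instances of a partial fixed point that fills in the values in
the order of a rank (`partialFix_eq_of_rank`).

Formulas are not written out except in the first part. Instead, `DefP Γ P` states that the semantic
predicate `P` is expressed by a formula with free variables in the context `Γ`, and closure properties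
of `DefP` replace the syntax.
-/

/-! ### Dependence of formulas on their free variables -/

namespace PFPC

variable {L : FirstOrder.Language.{0, 0}} {V : Type}

/-- Two assignments agree at a variable of either kind. -/
def Assignment.AgreeAt (ρ ρ' : Assignment V) : FOVar ⊕ RelVar → Prop
  | Sum.inl x => ρ.fo x = ρ'.fo x
  | Sum.inr X => ρ.rel X = ρ'.rel X

theorem Assignment.AgreeAt.set {ρ ρ' : Assignment V} {v : FOVar ⊕ RelVar} {x : FOVar}
    (h : v ≠ Sum.inl x → ρ.AgreeAt ρ' v) (a : Dom V x.1) : (ρ.set x a).AgreeAt (ρ'.set x a) v := by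
  rcases v with y | Y
  · by_cases hy : y = x
    · subst hy; simp [AgreeAt, Assignment.set]
    · have := h (by simpa using hy)
      simpa [AgreeAt, Assignment.set, Function.update_of_ne hy] using this
  · exact h (by simp)

theorem Assignment.AgreeAt.setRel {ρ ρ' : Assignment V} {v : FOVar ⊕ RelVar} {X : RelVar}
    (h : v ≠ Sum.inr X → ρ.AgreeAt ρ' v) (S : Set (Tuple V X.1)) :
    (ρ.setRel X S).AgreeAt (ρ'.setRel X S) v := by
  rcases v with y | Y
  · exact h (by simp)
  · by_cases hy : Y = X
    · subst hy; simp [AgreeAt, Assignment.setRel]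
    · have := h (by simpa using hy)
      simpa [AgreeAt, Assignment.setRel, Function.update_of_ne hy] using this

theorem Assignment.AgreeAt.setTuple {v : FOVar ⊕ RelVar} : ∀ {ρ ρ' : Assignment V}
    (xs : List FOVar) (_ : v ∉ xs.map Sum.inl → ρ.AgreeAt ρ' v)
    (as : Tuple V (xs.map Prod.fst)), (ρ.setTuple xs as).AgreeAt (ρ'.setTuple xs as) v
  | _, _, [], h, _ => h (by simp)
  | _, _, x :: xs, h, as => by
    refine Assignment.AgreeAt.setTuple xs (fun hv => ?_) as.2
    refine Assignment.AgreeAt.set (fun hx => h ?_) as.1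
    rw [List.map_cons, List.mem_cons, not_or]
    exact ⟨hx, hv⟩

variable [L.Structure V] [Finite V]

mutual

theorem Term.eval_congr : ∀ {s : Srt} (t : Term L s) {ρ ρ' : Assignment V},
    (∀ v ∈ t.fv, ρ.AgreeAt ρ' v) → t.eval ρ = t.eval ρ'
  | _, .var s x, _, _, h => by
    simpa [Term.eval, Assignment.AgreeAt] using h (Sum.inl (s, x)) (by simp [Term.fv])
  | _, .const c, _, _, _ => by simp only [Term.eval]; rfl
  | _, .count x φ, _, _, h => by
    simp only [Term.eval]
    congr 1
    funext a
    refine propext (φ.sat_congr fun v hv =>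
      Assignment.AgreeAt.set (x := (Srt.elem, x)) (fun hx => h v ?_) a)
    simpa [Term.fv] using ⟨hv, hx⟩

theorem Args.eval_congr : ∀ {σ : List Srt} (ts : Args L σ) {ρ ρ' : Assignment V},
    (∀ v ∈ ts.fv, ρ.AgreeAt ρ' v) → ts.eval ρ = ts.eval ρ'
  | _, .nil, _, _, _ => by simp only [Args.eval]; rfl
  | _, .cons t ts, _, _, h => by
    simp only [Args.eval]
    rw [t.eval_congr fun v hv => h v (by simp [Args.fv, hv]),
      ts.eval_congr fun v hv => h v (by simp [Args.fv, hv])]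

/-- The truth value of a formula depends only on the values of its free variables. -/
theorem Formula.sat_congr : ∀ (φ : Formula L) {ρ ρ' : Assignment V},
    (∀ v ∈ φ.fv, ρ.AgreeAt ρ' v) → (φ.Sat ρ ↔ φ.Sat ρ')
  | .eq t u, _, _, h => by
    simp only [Formula.Sat]
    rw [t.eval_congr fun v hv => h v (by simp [Formula.fv, hv]),
      u.eval_congr fun v hv => h v (by simp [Formula.fv, hv])]
  | .le t u, _, _, h => by
    simp only [Formula.Sat]
    rw [t.eval_congr fun v hv => h v (by simp [Formula.fv, hv]),
      u.eval_congr fun v hv => h v (by simp [Formula.fv, hv])]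
  | .rel R ts, ρ, ρ', h => by
    simp only [Formula.Sat]
    have : (fun i => (ts i).eval ρ) = fun i => (ts i).eval ρ' :=
      funext fun i => (ts i).eval_congr fun v hv => h v (by
        simp only [Formula.fv, Finset.mem_biUnion]; exact ⟨i, Finset.mem_univ _, hv⟩)
    rw [this]
  | .relVar X ts, ρ, ρ', h => by
    have hX : ρ.rel X = ρ'.rel X := h (Sum.inr X) (by simp [Formula.fv])
    simp only [Formula.Sat]
    rw [ts.eval_congr fun v hv => h v (by simp [Formula.fv, hv]), hX]
  | .neg φ, _, _, h => by
    simp only [Formula.Sat]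
    rw [φ.sat_congr fun v hv => h v (by simpa [Formula.fv] using hv)]
  | .and φ ψ, _, _, h => by
    simp only [Formula.Sat]
    rw [φ.sat_congr fun v hv => h v (by simp [Formula.fv, hv]),
      ψ.sat_congr fun v hv => h v (by simp [Formula.fv, hv])]
  | .or φ ψ, _, _, h => by
    simp only [Formula.Sat]
    rw [φ.sat_congr fun v hv => h v (by simp [Formula.fv, hv]),
      ψ.sat_congr fun v hv => h v (by simp [Formula.fv, hv])]
  | .all x φ, _, _, h => by
    simp only [Formula.Sat]
    refine forall_congr' fun a => φ.sat_congr fun v hv =>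
      Assignment.AgreeAt.set (fun hx => h v ?_) a
    simpa [Formula.fv] using ⟨hv, hx⟩
  | .ex x φ, _, _, h => by
    simp only [Formula.Sat]
    refine exists_congr fun a => φ.sat_congr fun v hv =>
      Assignment.AgreeAt.set (fun hx => h v ?_) a
    simpa [Formula.fv] using ⟨hv, hx⟩
  | .pfp X xs hxs φ ts, ρ, ρ', h => by
    simp only [Formula.Sat]
    rw [ts.eval_congr fun v hv => h v (by simp [Formula.fv, hv])]
    have : (fun S : Set (Tuple V (xs.map Prod.fst)) =>
        {as | φ.Sat ((ρ.setRel (xs.map Prod.fst, X) S).setTuple xs as)}) = fun S =>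
        {as | φ.Sat ((ρ'.setRel (xs.map Prod.fst, X) S).setTuple xs as)} := by
      funext S
      ext as
      refine φ.sat_congr fun v hv => Assignment.AgreeAt.setTuple xs (fun h1 => ?_) as
      refine Assignment.AgreeAt.setRel (X := (xs.map Prod.fst, X)) (fun h2 => h v ?_) S
      simp only [Formula.fv, Finset.mem_union, Finset.mem_sdiff, Finset.mem_singleton,
        List.mem_toFinset]
      exact Or.inl ⟨hv, not_or.2 ⟨h1, h2⟩⟩
    rw [this]

end

end PFPC

namespace PFPC

/-! ### The binary counter -/

section Counter

variable {α : Type} [LinearOrder α]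

/-- The successor of a set read as a binary number, the position of a digit being the position of
an element in the order: a digit changes if and only if all lower digits are `1`. -/
def binSucc (S : Set α) : Set α := {a | ¬(a ∈ S ↔ ∀ b < a, b ∈ S)}

theorem mem_binSucc {S : Set α} {a : α} : a ∈ binSucc S ↔ ¬(a ∈ S ↔ ∀ b < a, b ∈ S) := Iff.rfl

/-- The binary counter runs through all sets. -/
theorem exists_iterate_binSucc [Finite α] (S : Set α) : ∃ i : ℕ, binSucc^[i] ∅ = S := by
  -- Reachability is closed under changing the digits up to any given position.
  have key : ∀ a : α, ∀ S : Set α, (∃ i : ℕ, binSucc^[i] ∅ = S \ Set.Iic a) →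
      ∃ i : ℕ, binSucc^[i] ∅ = S := by
    intro a
    induction a using WellFoundedLT.induction with
    | ind a ih =>
      have below : ∀ T : Set α, (∃ i : ℕ, binSucc^[i] ∅ = T \ Set.Iio a) →
          ∃ i : ℕ, binSucc^[i] ∅ = T := by
        intro T hT
        rcases (Set.Iio a).eq_empty_or_nonempty with h0 | h0
        · simpa [h0] using hT
        · obtain ⟨b, hb, hmax⟩ := Set.exists_max_image _ id (Set.toFinite (Set.Iio a)) h0
          have : Set.Iio a = Set.Iic b := by
            ext c
            exact ⟨fun hc => hmax c hc, fun hc => lt_of_le_of_lt (show c ≤ b from hc) hb⟩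
          exact ih b hb T (this ▸ hT)
      intro S hS
      by_cases haS : a ∈ S
      · -- The predecessor of `S \ Iio a` has all digits below `a` set, and the digit `a` not set.
        obtain ⟨i, hi⟩ := below (S \ Set.Iic a ∪ Set.Iio a) (by
          obtain ⟨i, hi⟩ := hS
          refine ⟨i, hi.trans ?_⟩
          ext c
          simp only [Set.mem_sdiff, Set.mem_Iic, Set.mem_union, Set.mem_Iio, not_le, not_lt]
          constructor
          · rintro ⟨h1, h2⟩; exact ⟨Or.inl ⟨h1, h2⟩, h2.le⟩
          · rintro ⟨h1 | h1, h2⟩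
            · exact h1
            · exact absurd h1 (not_lt.2 h2))
        refine below S ⟨i + 1, ?_⟩
        rw [Function.iterate_succ_apply', hi]
        ext c
        simp only [mem_binSucc, Set.mem_sdiff, Set.mem_Iic, Set.mem_union, Set.mem_Iio, not_le,
          not_lt]
        rcases lt_trichotomy c a with h | h | h
        · have : ∀ b < c, b ∈ S ∧ a < b ∨ b < a := fun b hb => Or.inr (hb.trans h)
          simp only [iff_true_intro this, h.not_gt, h, and_false, or_true,
            not_true_eq_false, h.not_ge]
        · subst h
          simp +contextual [haS]
        · have : ¬ ∀ b < c, b ∈ S ∧ a < b ∨ b < a := fun hb => by simpa using hb a h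
          simp [h, this, h.le, h.not_gt]
      · refine below S ?_
        obtain ⟨i, hi⟩ := hS
        refine ⟨i, hi.trans ?_⟩
        ext c
        simp only [Set.mem_sdiff, Set.mem_Iic, Set.mem_Iio, not_le, not_lt]
        exact and_congr_right fun hc => ⟨le_of_lt, fun h => lt_of_le_of_ne h fun h' => haS (h' ▸ hc)⟩
  rcases isEmpty_or_nonempty α with h | h
  · exact ⟨0, Subsingleton.elim _ _⟩
  · obtain ⟨a, ha⟩ := Finite.exists_max (id : α → α)
    refine key a S ⟨0, ?_⟩
    ext c
    simpa using fun _ => ha c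

theorem binSucc_ne [Finite α] [Nonempty α] (S : Set α) : binSucc S ≠ S := by
  obtain ⟨a, ha⟩ := Finite.exists_min (id : α → α)
  intro h
  have h1 : a ∈ binSucc S ↔ a ∈ S := by rw [h]
  have h2 : ∀ b < a, b ∈ S := fun b hb => absurd (ha b) (not_le.2 hb)
  rw [mem_binSucc] at h1
  tauto

/-- If the binary counter is run as long as it meets sets with property `p`, then the partial fixed
point is the first set without this property, or `∅` if there is none. -/
theorem partialFix_binSucc_eq_empty_iff [Finite α] [Nonempty α] (p : Set α → Prop) (h0 : p ∅)
    (F : Set α → Set α) (hF : ∀ S, p S → F S = binSucc S) (hF' : ∀ S, ¬ p S → F S = S) :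
    partialFix F = ∅ ↔ ∀ S, p S := by
  constructor
  · intro h
    by_contra! hp
    have hex : ∃ i : ℕ, ¬ p (binSucc^[i] ∅) := by
      obtain ⟨S, hS⟩ := hp
      obtain ⟨i, rfl⟩ := exists_iterate_binSucc S
      exact ⟨i, hS⟩
    classical
    have hiter : ∀ i ≤ Nat.find hex, F^[i] ∅ = binSucc^[i] ∅ := by
      intro i
      induction i with
      | zero => simp
      | succ i ih =>
        intro hi
        rw [Function.iterate_succ_apply', Function.iterate_succ_apply', ih (by omega)]
        exact hF _ (not_not.1 (Nat.find_min hex (by omega)))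
    have hfix := Nat.find_spec hex
    rw [← hiter _ le_rfl] at hfix
    have hne : (F^[Nat.find hex] ∅).Nonempty :=
      Set.nonempty_iff_ne_empty.2 fun h' => hfix (by rw [h']; exact h0)
    obtain ⟨a, ha⟩ := hne
    have : a ∈ partialFix F := ⟨_, hF' _ hfix, ha⟩
    simp [h] at this
  · intro h
    refine Set.eq_empty_of_forall_notMem ?_
    rintro a ⟨i, hi, -⟩
    exact binSucc_ne _ ((hF _ (h _)).symm.trans hi)

/-- A partial fixed point that tests a property of `∅`. -/
theorem partialFix_eq_empty_iff_of_empty {α : Type} [Nonempty α] (p : Prop)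
    (F : Set α → Set α) (hF : F ∅ = {_a | p}) (hF' : ∀ S, S ≠ ∅ → F S = Set.univ) :
    partialFix F = ∅ ↔ ¬ p := by
  constructor
  · intro h hp
    have h1 : F ∅ = Set.univ := by rw [hF]; ext; simpa using hp
    obtain ⟨a⟩ := ‹Nonempty α›
    have : a ∈ partialFix F := ⟨1, by
      simp only [Function.iterate_one]
      rw [h1, hF' _ Set.univ_nonempty.ne_empty], by simp [h1]⟩
    simp [h] at this
  · intro hp
    have h1 : F ∅ = ∅ := by rw [hF]; ext; simpa using hp
    refine Set.eq_empty_of_forall_notMem ?_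
    rintro a ⟨i, -, hi⟩
    rw [Function.iterate_fixed h1] at hi
    exact hi

end Counter

/-! ### Quantification over binary relations on the number domain -/

/-- The type of binary relations on the number domain. -/
abbrev numNum : List Srt := [Srt.num, Srt.num]

variable {V : Type}

/-- The pair of `a` and `b` as a tuple. -/
def Tuple.mk2 {s t : Srt} (a : Dom V s) (b : Dom V t) : Tuple V [s, t] := (a, b, ())

noncomputable instance : LinearOrder (Dom V Srt.num) := inferInstanceAs (LinearOrder (Fin _))

/-- The lexicographic order on pairs of numbers. -/
noncomputable instance : LinearOrder (Tuple V numNum) :=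
  LinearOrder.lift'
    (fun t => (toLex ((t.1, t.2.1) : Dom V Srt.num × Dom V Srt.num)))
    (by
      rintro ⟨a, b, ⟨⟩⟩ ⟨c, d, ⟨⟩⟩ h
      have h' := toLex.injective h
      obtain ⟨rfl, rfl⟩ := Prod.mk.inj h'
      rfl)

instance : Finite (Dom V Srt.num) := inferInstanceAs (Finite (Fin _))
instance : Nonempty (Dom V Srt.num) := inferInstanceAs (Nonempty (Fin _))
instance : Finite (Tuple V numNum) :=
  inferInstanceAs (Finite (Dom V Srt.num × Dom V Srt.num × Unit))
instance : Nonempty (Tuple V numNum) :=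
  inferInstanceAs (Nonempty (Dom V Srt.num × Dom V Srt.num × Unit))

theorem mk2_lt_mk2_iff {a b c d : Dom V Srt.num} :
    Tuple.mk2 a b < Tuple.mk2 c d ↔ a < c ∨ a = c ∧ b < d :=
  Prod.Lex.toLex_lt_toLex

variable {L : FirstOrder.Language.{0, 0}}

/-- The number variable with name `x`. -/
abbrev numVar (x : ℕ) : Term L Srt.num := .var Srt.num x

/-- The atomic formula `R x y` with number variables `x` and `y`. -/
abbrev relAtom (R x y : ℕ) : Formula L :=
  .relVar (numNum, R) (.cons (numVar x) (.cons (numVar y) .nil))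

/-- The pair of the numbers `u` and `v` precedes that of `x` and `y`. -/
def lexLt (u v x y : ℕ) : Formula L :=
  .or (.neg (.le (numVar x) (numVar u)))
    (.and (.eq (numVar u) (numVar x)) (.neg (.le (numVar y) (numVar v))))

/-- All digits of `R` below the position given by `x` and `y` are set; `u` and `v` are auxiliary
variables. -/
def allBelow (R u v x y : ℕ) : Formula L :=
  .all (Srt.num, u) (.all (Srt.num, v) (.or (.neg (lexLt u v x y)) (relAtom R u v)))

/-- One step of the binary counter on `R`, as long as `θ` holds. -/
def counterStep (θ : Formula L) (R u v x y : ℕ) : Formula L :=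
  .or (.and θ (.or (.and (relAtom R x y) (.neg (allBelow R u v x y)))
      (.and (.neg (relAtom R x y)) (allBelow R u v x y))))
    (.and (.neg θ) (relAtom R x y))

/-- The operator for which the partial fixed point tests `θ` at `R = ∅`. -/
def emptyStep (θ : Formula L) (R u v : ℕ) : Formula L :=
  .or (.ex (Srt.num, u) (.ex (Srt.num, v) (relAtom R u v))) θ

/-- The partial fixed point of `φ` is nonempty. -/
def pfpNonempty (φ : Formula L) (R x y : ℕ) (h : x ≠ y) : Formula L :=
  .ex (Srt.num, x) (.ex (Srt.num, y)
    (.pfp R [(Srt.num, x), (Srt.num, y)] (by simpa using h) φ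
      (.cons (numVar x) (.cons (numVar y) .nil))))

section

variable [L.Structure V] [Finite V] {ρ : Assignment V}

theorem sat_eq {s : Srt} {t u : Term L s} : (Formula.eq t u).Sat ρ ↔ t.eval ρ = u.eval ρ := by
  simp only [Formula.Sat]

theorem sat_le {t u : Term L Srt.num} : (Formula.le t u).Sat ρ ↔ t.eval ρ ≤ u.eval ρ := by
  simp only [Formula.Sat]; rfl

theorem sat_neg {φ : Formula L} : φ.neg.Sat ρ ↔ ¬ φ.Sat ρ := by
  simp only [Formula.Sat]

theorem sat_and {φ ψ : Formula L} : (φ.and ψ).Sat ρ ↔ φ.Sat ρ ∧ ψ.Sat ρ := by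
  simp only [Formula.Sat]

theorem sat_or {φ ψ : Formula L} : (φ.or ψ).Sat ρ ↔ φ.Sat ρ ∨ ψ.Sat ρ := by
  simp only [Formula.Sat]

theorem sat_all {x : FOVar} {φ : Formula L} :
    (φ.all x).Sat ρ ↔ ∀ a : Dom V x.1, φ.Sat (ρ.set x a) := by
  simp only [Formula.Sat]

theorem sat_ex {x : FOVar} {φ : Formula L} :
    (φ.ex x).Sat ρ ↔ ∃ a : Dom V x.1, φ.Sat (ρ.set x a) := by
  simp only [Formula.Sat]

theorem sat_relAtom {R x y : ℕ} : (relAtom (L := L) R x y).Sat ρ ↔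
    Tuple.mk2 (ρ.fo (Srt.num, x)) (ρ.fo (Srt.num, y)) ∈ ρ.rel (numNum, R) := by
  simp only [Formula.Sat, Args.eval, Term.eval, Tuple.mk2]

theorem sat_allBelow {R u v x y : ℕ} (huv : u ≠ v) (hux : u ≠ x) (huy : u ≠ y) (hvx : v ≠ x)
    (hvy : v ≠ y) :
    (allBelow (L := L) R u v x y).Sat ρ ↔
      ∀ t < Tuple.mk2 (ρ.fo (Srt.num, x)) (ρ.fo (Srt.num, y)),
        t ∈ ρ.rel (numNum, R) := by
  have h : ∀ n m : ℕ, n ≠ m → ((Srt.num, n) : FOVar) ≠ (Srt.num, m) := by simp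
  simp only [allBelow, lexLt, sat_le, sat_relAtom, sat_eq, sat_neg, sat_and, sat_or, sat_all,
    Term.eval, Assignment.set,
    Function.update_self, Function.update_of_ne (h _ _ huv), Function.update_of_ne (h _ _ hux.symm),
    Function.update_of_ne (h _ _ huy.symm), Function.update_of_ne (h _ _ hvx.symm),
    Function.update_of_ne (h _ _ hvy.symm), not_le]
  constructor
  · rintro h ⟨a, b, ⟨⟩⟩ hab
    exact (h a b).resolve_left (not_not.2 (mk2_lt_mk2_iff.1 hab))
  · intro h a b
    exact or_iff_not_imp_left.2 fun hab => h (Tuple.mk2 a b) (mk2_lt_mk2_iff.2 (not_not.1 hab))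

theorem sat_counterStep {θ : Formula L} {R u v x y : ℕ} (huv : u ≠ v) (hux : u ≠ x) (huy : u ≠ y)
    (hvx : v ≠ x) (hvy : v ≠ y) :
    (counterStep θ R u v x y).Sat ρ ↔
      θ.Sat ρ ∧ Tuple.mk2 (ρ.fo (Srt.num, x)) (ρ.fo (Srt.num, y)) ∈
        binSucc (ρ.rel (numNum, R)) ∨
      ¬ θ.Sat ρ ∧ Tuple.mk2 (ρ.fo (Srt.num, x)) (ρ.fo (Srt.num, y)) ∈
        ρ.rel (numNum, R) := by
  have : (counterStep θ R u v x y).Sat ρ ↔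
      (θ.Sat ρ ∧ ((relAtom (L := L) R x y).Sat ρ ∧ ¬ (allBelow (L := L) R u v x y).Sat ρ ∨
        ¬ (relAtom (L := L) R x y).Sat ρ ∧ (allBelow (L := L) R u v x y).Sat ρ) ∨
      ¬ θ.Sat ρ ∧ (relAtom (L := L) R x y).Sat ρ) := by
    simp only [counterStep, sat_neg, sat_and, sat_or]
  rw [this, sat_allBelow huv hux huy hvx hvy, mem_binSucc, sat_relAtom]
  tauto

theorem sat_emptyStep {θ : Formula L} {R u v : ℕ} (huv : u ≠ v) :
    (emptyStep θ R u v).Sat ρ ↔ ρ.rel (numNum, R) ≠ ∅ ∨ θ.Sat ρ := by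
  have h : ((Srt.num, u) : FOVar) ≠ (Srt.num, v) := by simpa using huv
  simp only [emptyStep, sat_relAtom, sat_or, sat_ex, Assignment.set,
    Function.update_self, Function.update_of_ne h]
  refine or_congr_left ?_
  rw [← Set.nonempty_iff_ne_empty]
  constructor
  · rintro ⟨a, b, hab⟩
    exact ⟨_, hab⟩
  · rintro ⟨⟨a, b, ⟨⟩⟩, hab⟩
    exact ⟨a, b, hab⟩

theorem sat_pfpNonempty {φ : Formula L} {R x y : ℕ} (h : x ≠ y)
    (F : Set (Tuple V numNum) → Set (Tuple V numNum))
    (hF : ∀ a b S c d, Tuple.mk2 c d ∈ F S ↔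
      φ.Sat (((((ρ.set (Srt.num, x) a).set (Srt.num, y) b).setRel (numNum, R) S).set
        (Srt.num, x) c).set (Srt.num, y) d)) :
    (pfpNonempty φ R x y h).Sat ρ ↔ ¬ partialFix F = ∅ := by
  have h' : ((Srt.num, x) : FOVar) ≠ (Srt.num, y) := by simpa using h
  rw [← ne_eq, ← Set.nonempty_iff_ne_empty]
  simp only [pfpNonempty, Formula.Sat, Args.eval, Term.eval]
  have key : ∀ a b, (fun S : Set (Tuple V numNum) => {as : Tuple V numNum | φ.Sat
      ((((ρ.set (Srt.num, x) a).set (Srt.num, y) b).setRel (numNum, R) S).setTuple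
        [(Srt.num, x), (Srt.num, y)] as)}) = F := by
    intro a b
    funext S
    ext ⟨c, d, ⟨⟩⟩
    exact (hF a b S c d).symm
  constructor
  · rintro ⟨a, b, hab⟩
    exact ⟨_, (key a b) ▸ hab⟩
  · rintro ⟨⟨a, b, ⟨⟩⟩, hab⟩
    refine ⟨a, b, ?_⟩
    have hval : ((((ρ.set (Srt.num, x) a).set (Srt.num, y) b).fo (Srt.num, x) : Dom V Srt.num),
        (((ρ.set (Srt.num, x) a).set (Srt.num, y) b).fo (Srt.num, y) : Dom V Srt.num), ()) =
        (a, b, ()) := by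
      simp [Assignment.set, Function.update_of_ne h']
    exact Set.mem_of_eq_of_mem hval ((key a b).symm ▸ hab)

end

/-- The formula expressing that `θ` holds for all binary relations `R` on the number domain, where
the number variables with names `N, …, N + 3` are not free in `θ`. -/
def allNumRel (θ : Formula L) (R N : ℕ) : Formula L :=
  .and (pfpNonempty (emptyStep θ R (N + 2) (N + 3)) R N (N + 1) (by omega))
    (.neg (pfpNonempty (counterStep θ R (N + 2) (N + 3) N (N + 1)) R N (N + 1) (by omega)))

theorem fv_allNumRel (θ : Formula L) (R N : ℕ) :
    (allNumRel θ R N).fv ⊆ θ.fv \ {Sum.inr (numNum, R)} := by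
  intro v hv
  simp only [allNumRel, pfpNonempty, emptyStep, counterStep, allBelow, lexLt, relAtom, numVar,
    Formula.fv, Args.fv, Term.fv, Finset.mem_union, Finset.mem_sdiff, Finset.mem_singleton,
    List.mem_toFinset, List.map_cons, List.map_nil, List.mem_cons, Finset.notMem_empty] at hv ⊢
  tauto

theorem sat_allNumRel (θ : Formula L) (R N : ℕ) (hN : ∀ x, Sum.inl (Srt.num, x) ∈ θ.fv → x < N)
    [L.Structure V] [Finite V] (ρ : Assignment V) :
    (allNumRel θ R N).Sat ρ ↔ ∀ S : Set (Tuple V numNum), θ.Sat (ρ.setRel (numNum, R) S) := by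
  set p : Set (Tuple V numNum) → Prop := fun S => θ.Sat (ρ.setRel (numNum, R) S) with hp
  have hθ : ∀ a b S c d, θ.Sat (((((ρ.set (Srt.num, N) a).set (Srt.num, N + 1) b).setRel
      (numNum, R) S).set (Srt.num, N) c).set (Srt.num, N + 1) d) ↔ p S := by
    intro a b S c d
    refine θ.sat_congr ?_
    rintro (⟨s, x⟩ | X) hv
    · have h : ∀ m, N ≤ m → ((s, x) : FOVar) ≠ (Srt.num, m) := by
        rintro m hm h
        obtain ⟨rfl, rfl⟩ := Prod.mk.inj h
        exact absurd (hN _ hv) (not_lt.2 hm)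
      simp [Assignment.AgreeAt, Assignment.set, Assignment.setRel, Function.update_of_ne (h N le_rfl),
        Function.update_of_ne (h (N + 1) (by omega))]
    · simp [Assignment.AgreeAt, Assignment.set, Assignment.setRel]
  have hxy : ((Srt.num, N) : FOVar) ≠ (Srt.num, N + 1) := by simp
  classical
  set F : Set (Tuple V numNum) → Set (Tuple V numNum) := fun S => if p S then binSucc S else S
  set F₀ : Set (Tuple V numNum) → Set (Tuple V numNum) := fun S => {_t | S ≠ ∅ ∨ p S}
  have h1 := sat_pfpNonempty (L := L) (ρ := ρ) (R := R) (show N ≠ N + 1 by omega) F₀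
    (φ := emptyStep θ R (N + 2) (N + 3)) (by
      intro a b S c d
      rw [sat_emptyStep (by omega), hθ]
      simp only [F₀, Assignment.set, Assignment.setRel, Function.update_self]
      rfl)
  have h2 := sat_pfpNonempty (L := L) (ρ := ρ) (R := R) (show N ≠ N + 1 by omega) F
    (φ := counterStep θ R (N + 2) (N + 3) N (N + 1)) (by
      intro a b S c d
      rw [sat_counterStep (by omega) (by omega) (by omega) (by omega) (by omega), hθ]
      simp only [Assignment.set, Assignment.setRel, Function.update_self,
        Function.update_of_ne hxy]
      by_cases hS : p S <;> simp [F, hS])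
  rw [allNumRel, Formula.Sat, Formula.Sat, h1, h2, not_not,
    partialFix_eq_empty_iff_of_empty (p ∅) F₀ (by simp [F₀]) (by
      intro S hS; simp [F₀, hS]), not_not]
  constructor
  · rintro ⟨h0, h⟩
    exact (partialFix_binSucc_eq_empty_iff p h0 F (by simp +contextual [F])
      (by simp +contextual [F])).1 h
  · intro h
    exact ⟨h ∅, (partialFix_binSucc_eq_empty_iff p (h ∅) F (by simp +contextual [F])
      (by simp +contextual [F])).2 h⟩

/-- Partial fixed-point logic with counting can quantify over binary relations on the number
domain. -/
theorem exists_allNumRel (L : FirstOrder.Language.{0, 0}) (θ : Formula L) (R : ℕ) :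
    ∃ ψ : Formula L, ψ.fv ⊆ θ.fv \ {Sum.inr ([Srt.num, Srt.num], R)} ∧
      ∀ (V : Type) [L.Structure V] [Finite V] (ρ : Assignment V),
        ψ.Sat ρ ↔ ∀ S : Set (Tuple V [Srt.num, Srt.num]),
          θ.Sat (ρ.setRel ([Srt.num, Srt.num], R) S) := by
  have hN : ∃ N, ∀ v ∈ θ.fv, v.elim Prod.snd (fun _ => 0) < N :=
    ⟨θ.fv.sup (fun v => v.elim Prod.snd fun _ => 0) + 1, fun v hv =>
      Nat.lt_succ_of_le (Finset.le_sup (f := fun v => v.elim Prod.snd fun _ => 0) hv)⟩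
  obtain ⟨N, hN⟩ := hN
  exact ⟨allNumRel θ R N, fv_allNumRel θ R N, fun V _ _ ρ =>
    sat_allNumRel θ R N (fun x hx => hN _ hx) ρ⟩

end PFPC

namespace PFPC

/-! ### Definable predicates -/

/-- The kinds of variables: first-order variables of a sort, and relation variables of a type. -/
inductive Kind : Type
  | fo (s : Srt)
  | rel (σ : List Srt)
  deriving DecidableEq

/-- The possible values of a variable of a given kind. -/
def Kind.Val (V : Type) : Kind → Type
  | .fo s => Dom V s
  | .rel σ => Set (Tuple V σ)

/-- The variable of a given kind with name `N`. -/
def Kind.toVar (N : ℕ) : Kind → FOVar ⊕ RelVar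
  | .fo s => Sum.inl (s, N)
  | .rel σ => Sum.inr (σ, N)

/-- The value of the variable of a given kind with name `N`. -/
def Assignment.value {V : Type} (ρ : Assignment V) (N : ℕ) : (k : Kind) → k.Val V
  | .fo s => ρ.fo (s, N)
  | .rel σ => ρ.rel (σ, N)

/-- Values for the variables of a context. A context is the list of the kinds of its variables; the
variable at the head of `k :: Γ` has the length of `Γ` as its name, so that the variables of `Γ`
keep their names when the context is extended. -/
def Env (V : Type) : List Kind → Type
  | [] => Unit
  | k :: Γ => k.Val V × Env V Γ

/-- The values under an assignment of the variables of a context. -/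
def Assignment.read {V : Type} (ρ : Assignment V) : (Γ : List Kind) → Env V Γ
  | [] => ()
  | k :: Γ => (ρ.value Γ.length k, ρ.read Γ)

/-- The variables of a context. -/
def vars : List Kind → Finset (FOVar ⊕ RelVar)
  | [] => ∅
  | k :: Γ => insert (k.toVar Γ.length) (vars Γ)

theorem Assignment.read_set {V : Type} (ρ : Assignment V) {s : Srt} {N : ℕ} (a : Dom V s) :
    ∀ Γ : List Kind, Γ.length ≤ N → (ρ.set (s, N) a).read Γ = ρ.read Γ
  | [], _ => rfl
  | k :: Γ, h => by
    rw [List.length_cons] at h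
    rw [read, read, read_set ρ a Γ (by omega)]
    cases k with
    | fo t =>
      have : ((t, Γ.length) : FOVar) ≠ (s, N) := fun h' => by
        have := congrArg Prod.snd h'
        simp only at this
        omega
      simp only [value, Assignment.set, Function.update_of_ne this]
      rfl
    | rel σ => rfl

theorem Assignment.read_setRel {V : Type} (ρ : Assignment V) {σ : List Srt} {N : ℕ}
    (S : Set (Tuple V σ)) :
    ∀ Γ : List Kind, Γ.length ≤ N → (ρ.setRel (σ, N) S).read Γ = ρ.read Γ
  | [], _ => rfl
  | k :: Γ, h => by
    rw [List.length_cons] at h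
    rw [read, read, read_setRel ρ S Γ (by omega)]
    cases k with
    | rel τ =>
      have : ((τ, Γ.length) : RelVar) ≠ (σ, N) := fun h' => by
        have := congrArg Prod.snd h'
        simp only at this
        omega
      simp only [value, Assignment.setRel, Function.update_of_ne this]
      rfl
    | fo s => rfl

theorem Assignment.read_cons_fo {V : Type} (ρ : Assignment V) {s : Srt} (a : Dom V s)
    (Γ : List Kind) : (ρ.set (s, Γ.length) a).read (.fo s :: Γ) = (a, ρ.read Γ) := by
  rw [read, read_set _ _ _ le_rfl]
  simp only [value, Assignment.set, Function.update_self]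
  rfl

theorem Assignment.read_cons_rel {V : Type} (ρ : Assignment V) {σ : List Srt} (S : Set (Tuple V σ))
    (Γ : List Kind) : (ρ.setRel (σ, Γ.length) S).read (.rel σ :: Γ) = (S, ρ.read Γ) := by
  rw [read, read_setRel _ _ _ le_rfl]
  simp only [value, Assignment.setRel, Function.update_self]
  rfl

theorem toVar_notMem_vars (k : Kind) (N : ℕ) :
    ∀ Γ : List Kind, Γ.length ≤ N → k.toVar N ∉ vars Γ
  | [], _ => by simp [vars]
  | k' :: Γ, h => by
    rw [List.length_cons] at h
    rw [vars, Finset.mem_insert, not_or]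
    refine ⟨fun h' => ?_, toVar_notMem_vars k N Γ (by omega)⟩
    cases k <;> cases k' <;> simp [Kind.toVar] at h' <;> omega

/-- A finite structure. -/
structure Model (L : FirstOrder.Language.{0, 0}) : Type 1 where
  carrier : Type
  [str : L.Structure carrier]
  [fin : Finite carrier]

attribute [instance] Model.str Model.fin

variable {L : FirstOrder.Language.{0, 0}}

/-- The domain of a sort in a model. -/
abbrev Model.D (M : Model L) (s : Srt) : Type := Dom M.carrier s

/-- The values in a model for the variables of a context. -/
abbrev Model.Env (M : Model L) (Γ : List Kind) : Type := PFPC.Env M.carrier Γ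

/-- A predicate on the values of the variables of a context is definable if it is expressed by a
formula with free variables in the context, the same formula for all models. -/
def DefP (Γ : List Kind) (P : ∀ M : Model L, M.Env Γ → Prop) : Prop :=
  ∃ φ : Formula L, φ.fv ⊆ vars Γ ∧
    ∀ (M : Model L) (ρ : Assignment M.carrier), φ.Sat ρ ↔ P M (ρ.read Γ)

/-- A function on the values of the variables of a context that is the value of a term. -/
def DefT (Γ : List Kind) {s : Srt} (t : ∀ M : Model L, M.Env Γ → M.D s) : Prop :=
  ∃ τ : Term L s, τ.fv ⊆ vars Γ ∧
    ∀ (M : Model L) (ρ : Assignment M.carrier), τ.eval ρ = t M (ρ.read Γ)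

/-- A projection to the value of a relation variable in the context. -/
def IsRelVar (Γ : List Kind) {σ : List Srt} (R : ∀ M : Model L, M.Env Γ → Set (Tuple M.carrier σ)) :
    Prop :=
  ∃ X : ℕ, Sum.inr (σ, X) ∈ vars Γ ∧
    ∀ (M : Model L) (ρ : Assignment M.carrier), ρ.rel (σ, X) = R M (ρ.read Γ)

/-- The context `Δ` extends the context `Γ`. -/
structure Ext (Δ Γ : List Kind) : Type 1 where
  map : ∀ {V : Type}, Env V Δ → Env V Γ
  subset : vars Γ ⊆ vars Δ
  map_read : ∀ {V : Type} (ρ : Assignment V), map (ρ.read Δ) = ρ.read Γ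

namespace Ext

/-- The trivial extension. -/
def refl (Γ : List Kind) : Ext Γ Γ := ⟨id, subset_rfl, fun _ => rfl⟩

/-- The extension by a variable. -/
def cons (k : Kind) {Δ Γ : List Kind} (f : Ext Δ Γ) : Ext (k :: Δ) Γ :=
  ⟨fun e => f.map e.2, f.subset.trans (Finset.subset_insert _ _), fun ρ => f.map_read ρ⟩

/-- Composition of extensions. -/
def comp {Γ Δ Θ : List Kind} (f : Ext Δ Γ) (g : Ext Θ Δ) : Ext Θ Γ :=
  ⟨fun e => f.map (g.map e), f.subset.trans g.subset, fun ρ => by rw [g.map_read, f.map_read]⟩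

end Ext

variable {Γ Δ : List Kind} {a b c d s : Srt} {σ : List Srt}

/-! ### Variables and extension of contexts -/

theorem DefP.ext {P : ∀ M : Model L, M.Env Γ → Prop} (h : DefP Γ P) (f : Ext Δ Γ) :
    DefP Δ fun M e => P M (f.map e) := by
  obtain ⟨φ, hφ, h⟩ := h
  exact ⟨φ, hφ.trans f.subset, fun M ρ => by rw [h, ← f.map_read ρ]⟩

theorem DefT.ext {t : ∀ M : Model L, M.Env Γ → M.D s} (h : DefT Γ t) (f : Ext Δ Γ) :
    DefT Δ fun M e => t M (f.map e) := by
  obtain ⟨τ, hτ, h⟩ := h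
  exact ⟨τ, hτ.trans f.subset, fun M ρ => by rw [h, ← f.map_read ρ]⟩

theorem IsRelVar.ext {R : ∀ M : Model L, M.Env Γ → Set (Tuple M.carrier σ)} (h : IsRelVar Γ R)
    (f : Ext Δ Γ) : IsRelVar Δ fun M e => R M (f.map e) := by
  obtain ⟨X, hX, h⟩ := h
  exact ⟨X, f.subset hX, fun M ρ => by rw [h, ← f.map_read ρ]⟩

theorem DefT.weak {t : ∀ M : Model L, M.Env Γ → M.D s} (h : DefT Γ t) {k : Kind} :
    DefT (k :: Γ) fun M e => t M e.2 := h.ext (.cons k (.refl Γ))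

theorem IsRelVar.weak {R : ∀ M : Model L, M.Env Γ → Set (Tuple M.carrier σ)} (h : IsRelVar Γ R)
    {k : Kind} : IsRelVar (k :: Γ) fun M e => R M e.2 := h.ext (.cons k (.refl Γ))

theorem DefT.v0 : DefT (L := L) (s := s) (.fo s :: Γ) fun _ e => e.1 :=
  ⟨.var s Γ.length, by simp [Term.fv, vars, Kind.toVar], fun M ρ => by rw [Term.eval]; rfl⟩

theorem IsRelVar.v0 : IsRelVar (L := L) (σ := σ) (.rel σ :: Γ) fun _ e => e.1 :=
  ⟨Γ.length, by simp [vars, Kind.toVar], fun M ρ => rfl⟩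

section

variable {k₀ k₁ k₂ k₃ k₄ k₅ k₆ k₇ : Kind}

theorem DefT.v1 : DefT (L := L) (s := s) (k₀ :: .fo s :: Γ) fun _ e => e.2.1 := DefT.v0.weak

theorem DefT.v2 : DefT (L := L) (s := s) (k₀ :: k₁ :: .fo s :: Γ) fun _ e => e.2.2.1 :=
  DefT.v1.weak

theorem DefT.v3 : DefT (L := L) (s := s) (k₀ :: k₁ :: k₂ :: .fo s :: Γ) fun _ e => e.2.2.2.1 :=
  DefT.v2.weak

theorem DefT.v4 : DefT (L := L) (s := s) (k₀ :: k₁ :: k₂ :: k₃ :: .fo s :: Γ)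
    fun _ e => e.2.2.2.2.1 := DefT.v3.weak

theorem DefT.v5 : DefT (L := L) (s := s) (k₀ :: k₁ :: k₂ :: k₃ :: k₄ :: .fo s :: Γ)
    fun _ e => e.2.2.2.2.2.1 := DefT.v4.weak

end

/-! ### Logical operations -/

section

variable {P Q : ∀ M : Model L, M.Env Γ → Prop}

theorem DefP.neg (h : DefP Γ P) : DefP Γ fun M e => ¬ P M e := by
  obtain ⟨φ, hφ, h⟩ := h
  exact ⟨φ.neg, by simpa [Formula.fv] using hφ, fun M ρ => by rw [sat_neg, h]⟩

theorem DefP.and (h : DefP Γ P) (h' : DefP Γ Q) : DefP Γ fun M e => P M e ∧ Q M e := by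
  obtain ⟨φ, hφ, h⟩ := h
  obtain ⟨ψ, hψ, h'⟩ := h'
  exact ⟨φ.and ψ, by rw [Formula.fv]; exact Finset.union_subset hφ hψ,
    fun M ρ => by rw [sat_and, h, h']⟩

theorem DefP.or (h : DefP Γ P) (h' : DefP Γ Q) : DefP Γ fun M e => P M e ∨ Q M e := by
  obtain ⟨φ, hφ, h⟩ := h
  obtain ⟨ψ, hψ, h'⟩ := h'
  exact ⟨φ.or ψ, by rw [Formula.fv]; exact Finset.union_subset hφ hψ,
    fun M ρ => by rw [sat_or, h, h']⟩

theorem DefP.congr (h : DefP Γ P) (hPQ : ∀ M e, Q M e ↔ P M e) : DefP Γ Q := by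
  obtain ⟨φ, hφ, h⟩ := h
  exact ⟨φ, hφ, fun M ρ => by rw [h, hPQ]⟩

theorem DefP.imp (h : DefP Γ P) (h' : DefP Γ Q) : DefP Γ fun M e => P M e → Q M e :=
  (h.neg.or h').congr fun _ _ => imp_iff_not_or

theorem DefP.iff (h : DefP Γ P) (h' : DefP Γ Q) : DefP Γ fun M e => P M e ↔ Q M e :=
  ((h.imp h').and (h'.imp h)).congr fun _ _ => iff_iff_implies_and_implies

end

theorem DefP.ex {P : ∀ M : Model L, M.Env Γ → M.D s → Prop}
    (h : DefP (.fo s :: Γ) fun M e => P M e.2 e.1) : DefP Γ fun M e => ∃ x, P M e x := by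
  obtain ⟨φ, hφ, h⟩ := h
  refine ⟨φ.ex (s, Γ.length), ?_, fun M ρ => ?_⟩
  · rw [Formula.fv]
    exact sdiff_le_iff.2 (hφ.trans (by rw [vars, Finset.insert_eq]; rfl))
  · rw [sat_ex]
    exact exists_congr fun x => by rw [h, ρ.read_cons_fo]

theorem DefP.all {P : ∀ M : Model L, M.Env Γ → M.D s → Prop}
    (h : DefP (.fo s :: Γ) fun M e => P M e.2 e.1) : DefP Γ fun M e => ∀ x, P M e x :=
  (DefP.ex (P := fun M e x => ¬ P M e x) h.neg).neg.congr fun _ _ => by simp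

/-- Second-order quantification over binary relations on the number domain. -/
theorem DefP.allRel {P : ∀ M : Model L, M.Env Γ → Set (Tuple M.carrier numNum) → Prop}
    (h : DefP (.rel numNum :: Γ) fun M e => P M e.2 e.1) : DefP Γ fun M e => ∀ S, P M e S := by
  obtain ⟨φ, hφ, h⟩ := h
  obtain ⟨ψ, hψ, h'⟩ := exists_allNumRel L φ Γ.length
  refine ⟨ψ, hψ.trans ?_, fun M ρ => ?_⟩
  · exact sdiff_le_iff.2 (hφ.trans (by rw [vars, Finset.insert_eq]; rfl))
  · rw [h']
    refine forall_congr' fun S => ?_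
    rw [h, ρ.read_cons_rel]

theorem DefP.exRel {P : ∀ M : Model L, M.Env Γ → Set (Tuple M.carrier numNum) → Prop}
    (h : DefP (.rel numNum :: Γ) fun M e => P M e.2 e.1) : DefP Γ fun M e => ∃ S, P M e S :=
  (DefP.allRel (P := fun M e S => ¬ P M e S) h.neg).neg.congr fun _ _ => by simp

theorem DefP.eq {t u : ∀ M : Model L, M.Env Γ → M.D s} (ht : DefT Γ t) (hu : DefT Γ u) :
    DefP Γ fun M e => t M e = u M e := by
  obtain ⟨τ, hτ, ht⟩ := ht
  obtain ⟨υ, hυ, hu⟩ := hu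
  exact ⟨.eq τ υ, by rw [Formula.fv]; exact Finset.union_subset hτ hυ,
    fun M ρ => by rw [sat_eq, ht, hu]⟩

theorem DefP.le {t u : ∀ M : Model L, M.Env Γ → M.D Srt.num} (ht : DefT Γ t) (hu : DefT Γ u) :
    DefP Γ fun M e => t M e ≤ u M e := by
  obtain ⟨τ, hτ, ht⟩ := ht
  obtain ⟨υ, hυ, hu⟩ := hu
  exact ⟨.le τ υ, by rw [Formula.fv]; exact Finset.union_subset hτ hυ,
    fun M ρ => by rw [sat_le, ht, hu]⟩

theorem DefP.relMap₂ {R : L.Relations 2} {t u : ∀ M : Model L, M.Env Γ → M.D Srt.elem}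
    (ht : DefT Γ t) (hu : DefT Γ u) :
    DefP Γ fun M e => FirstOrder.Language.Structure.RelMap (M := M.carrier) R ![t M e, u M e] := by
  obtain ⟨τ, hτ, ht⟩ := ht
  obtain ⟨υ, hυ, hu⟩ := hu
  refine ⟨.rel R ![τ, υ], ?_, fun M ρ => ?_⟩
  · rw [Formula.fv, Finset.biUnion_subset]
    intro i _
    fin_cases i
    exacts [hτ, hυ]
  · simp only [Formula.Sat]
    rw [← ht, ← hu]
    refine iff_of_eq (congrArg _ (funext fun i => ?_))
    fin_cases i <;> rfl

/-- The term `# x φ`. -/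
theorem DefT.count {P : ∀ M : Model L, M.Env Γ → M.carrier → Prop}
    (h : DefP (.fo Srt.elem :: Γ) fun M e => P M e.2 e.1) :
    DefT Γ fun M e => countVal fun x => P M e x := by
  obtain ⟨φ, hφ, h⟩ := h
  refine ⟨.count Γ.length φ, ?_, fun M ρ => ?_⟩
  · rw [Term.fv]
    exact sdiff_le_iff.2 (hφ.trans (by rw [vars, Finset.insert_eq]; rfl))
  · rw [Term.eval]
    congr 1
    funext x
    exact propext (by rw [h]; erw [ρ.read_cons_fo (s := Srt.elem)])

/-! ### Relation variables and partial fixed points -/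

/-- A triple as a tuple. -/
def Tuple.mk3 {V : Type} (x : Dom V a) (y : Dom V b) (z : Dom V c) : Tuple V [a, b, c] :=
  (x, y, z, ())

/-- A quadruple as a tuple. -/
def Tuple.mk4 {V : Type} (x : Dom V a) (y : Dom V b) (z : Dom V c) (w : Dom V d) :
    Tuple V [a, b, c, d] :=
  (x, y, z, w, ())

section

variable {t : ∀ M : Model L, M.Env Γ → M.D a} {u : ∀ M : Model L, M.Env Γ → M.D b}
  {v : ∀ M : Model L, M.Env Γ → M.D c} {w : ∀ M : Model L, M.Env Γ → M.D d}

/-- A function on the values of the variables of a context that is the value of a tuple of terms. -/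
def DefArgs (Γ : List Kind) (t : ∀ M : Model L, M.Env Γ → Tuple M.carrier σ) : Prop :=
  ∃ τ : Args L σ, τ.fv ⊆ vars Γ ∧
    ∀ (M : Model L) (ρ : Assignment M.carrier), τ.eval ρ = t M (ρ.read Γ)

theorem DefArgs.nil : DefArgs (L := L) (σ := []) Γ fun _ _ => () :=
  ⟨.nil, by simp [Args.fv], fun M ρ => by rw [Args.eval]⟩

theorem DefArgs.cons {ts : ∀ M : Model L, M.Env Γ → Tuple M.carrier σ} (h : DefT Γ t)
    (hs : DefArgs Γ ts) : DefArgs (σ := a :: σ) Γ fun M e => (t M e, ts M e) := by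
  obtain ⟨τ, hτ, h⟩ := h
  obtain ⟨τs, hτs, hs⟩ := hs
  exact ⟨.cons τ τs, by rw [Args.fv]; exact Finset.union_subset hτ hτs,
    fun M ρ => by rw [Args.eval, h, hs]⟩

theorem DefArgs.mk2 (ht : DefT Γ t) (hu : DefT Γ u) :
    DefArgs Γ fun M e => Tuple.mk2 (t M e) (u M e) := .cons ht (.cons hu .nil)

theorem DefArgs.mk3 (ht : DefT Γ t) (hu : DefT Γ u) (hv : DefT Γ v) :
    DefArgs Γ fun M e => Tuple.mk3 (t M e) (u M e) (v M e) := .cons ht (.cons hu (.cons hv .nil))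

theorem DefArgs.mk4 (ht : DefT Γ t) (hu : DefT Γ u) (hv : DefT Γ v) (hw : DefT Γ w) :
    DefArgs Γ fun M e => Tuple.mk4 (t M e) (u M e) (v M e) (w M e) :=
  .cons ht (.cons hu (.cons hv (.cons hw .nil)))

theorem DefP.mem {ts : ∀ M : Model L, M.Env Γ → Tuple M.carrier σ} (hs : DefArgs Γ ts)
    {R : ∀ M : Model L, M.Env Γ → Set (Tuple M.carrier σ)} (hR : IsRelVar Γ R) :
    DefP Γ fun M e => ts M e ∈ R M e := by
  obtain ⟨τs, hτs, hs⟩ := hs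
  obtain ⟨X, hX, hR⟩ := hR
  refine ⟨.relVar (σ, X) τs, ?_, fun M ρ => ?_⟩
  · rw [Formula.fv]
    exact Finset.union_subset (Finset.singleton_subset_iff.2 hX) hτs
  · simp only [Formula.Sat]
    rw [hs, hR]

end

instance Tuple.finite {V : Type} [Finite V] : ∀ σ : List Srt, Finite (Tuple V σ)
  | [] => inferInstanceAs (Finite Unit)
  | Srt.elem :: σ => by
    have := Tuple.finite (V := V) σ
    exact inferInstanceAs (Finite (V × Tuple V σ))
  | Srt.num :: σ => by
    have := Tuple.finite (V := V) σ
    exact inferInstanceAs (Finite (Fin (Nat.card V + 1) × Tuple V σ))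

/-- Definition by recursion on a rank: if, on elements of a given rank, `F` maps every set agreeing
with `X` on smaller ranks to a set agreeing with `X`, then the partial fixed point of `F` is `X`. -/
theorem partialFix_eq_of_rank {α : Type} [Finite α] (F : Set α → Set α) (X : Set α) (rank : α → ℕ)
    (h : ∀ S x, (∀ y, rank y < rank x → (y ∈ S ↔ y ∈ X)) → (x ∈ F S ↔ x ∈ X)) :
    partialFix F = X := by
  have hfix : F X = X := Set.ext fun x => h X x fun _ _ => Iff.rfl
  have huniq : ∀ Y, F Y = Y → Y = X := by
    intro Y hY
    have : ∀ n x, rank x < n → (x ∈ Y ↔ x ∈ X) := by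
      intro n
      induction n with
      | zero => simp
      | succ n ih =>
        intro x hx
        rw [← h Y x fun y hy => ih y (by omega), hY]
    exact Set.ext fun x => this _ x (Nat.lt_succ_self _)
  have hiter : ∀ n x, rank x < n → (x ∈ F^[n] ∅ ↔ x ∈ X) := by
    intro n
    induction n with
    | zero => simp
    | succ n ih =>
      intro x hx
      rw [Function.iterate_succ_apply']
      exact h _ x fun y hy => ih y (by omega)
  obtain ⟨n, hn⟩ := (Set.finite_range rank).bddAbove
  have hX : F^[n + 1] ∅ = X :=
    Set.ext fun x => hiter _ x (Nat.lt_succ_of_le (hn ⟨x, rfl⟩))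
  ext x
  constructor
  · rintro ⟨i, hi, hx⟩
    exact huniq _ hi ▸ hx
  · intro hx
    exact ⟨n + 1, by rw [hX, hfix], hX ▸ hx⟩

/-- Recursive definition of a relation `X` by a partial fixed point `[pfp_{X, xs} φ](ts)`. The
formula `φ` expresses the predicate `Q` in the context `Θ`, the extension of `Γ` by `X` and `xs`;
the values of the variables of `Θ` are given by `body`. -/
theorem DefP.of_pfp {Θ : List Kind} (xs : List FOVar) (hxs : xs.Nodup)
    (body : ∀ {V : Type}, Env V Γ → Set (Tuple V (xs.map Prod.fst)) →
      Tuple V (xs.map Prod.fst) → Env V Θ)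
    (hread : ∀ {V : Type} (ρ : Assignment V) S as,
      ((ρ.setRel (xs.map Prod.fst, Γ.length) S).setTuple xs as).read Θ = body (ρ.read Γ) S as)
    (hvars : vars Θ ⊆ vars Γ ∪
      ((xs.map Sum.inl).toFinset ∪ {Sum.inr (xs.map Prod.fst, Γ.length)}))
    {Q : ∀ M : Model L, M.Env Θ → Prop} (hQ : DefP Θ Q)
    (X : ∀ M : Model L, M.Env Γ → Set (Tuple M.carrier (xs.map Prod.fst)))
    (rank : ∀ M : Model L, Tuple M.carrier (xs.map Prod.fst) → ℕ)
    (hX : ∀ M e S x, (∀ y, rank M y < rank M x → (y ∈ S ↔ y ∈ X M e)) →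
      (Q M (body e S x) ↔ x ∈ X M e))
    {ts : ∀ M : Model L, M.Env Γ → Tuple M.carrier (xs.map Prod.fst)} (hs : DefArgs Γ ts) :
    DefP Γ fun M e => ts M e ∈ X M e := by
  obtain ⟨φ, hφ, hQ⟩ := hQ
  obtain ⟨τs, hτs, hs⟩ := hs
  refine ⟨.pfp Γ.length xs hxs φ τs, ?_, fun M ρ => ?_⟩
  · rw [Formula.fv]
    refine Finset.union_subset ?_ hτs
    exact sdiff_le_iff.2 (hφ.trans (hvars.trans (Finset.union_comm _ _).subset))
  · simp only [Formula.Sat]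
    rw [hs, partialFix_eq_of_rank _ (X M (ρ.read Γ)) (rank M)]
    intro S x hx
    rw [← hX M _ S x hx, ← hread, ← hQ]
    rfl

section

variable {t : ∀ M : Model L, M.Env Γ → M.D a} {u : ∀ M : Model L, M.Env Γ → M.D b}
  {v : ∀ M : Model L, M.Env Γ → M.D c} {w : ∀ M : Model L, M.Env Γ → M.D d}

/-- Recursive definition of a binary relation, in the form of `partialFix_eq_of_rank`. -/
theorem DefP.rec₂
    {F : ∀ M : Model L, M.Env Γ → Set (Tuple M.carrier [a, b]) → M.D a → M.D b → Prop}
    (X : ∀ M : Model L, M.Env Γ → M.D a → M.D b → Prop)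
    (rank : ∀ M : Model L, M.D a → M.D b → ℕ)
    (hX : ∀ M e (S : Set (Tuple M.carrier [a, b])) x y,
      (∀ x' y', rank M x' y' < rank M x y → (Tuple.mk2 x' y' ∈ S ↔ X M e x' y')) →
      (F M e S x y ↔ X M e x y))
    (hF : DefP (.fo b :: .fo a :: .rel [a, b] :: Γ)
      fun M e => F M e.2.2.2 e.2.2.1 e.2.1 e.1) (ht : DefT Γ t) (hu : DefT Γ u) :
    DefP Γ fun M e => X M e (t M e) (u M e) :=
  DefP.of_pfp (Θ := .fo b :: .fo a :: .rel [a, b] :: Γ) [(a, Γ.length + 1), (b, Γ.length + 2)]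
    (by simp) (fun e S x => (x.2.1, x.1, S, e))
    (fun ρ S ⟨x, y, _⟩ => (Assignment.read_cons_fo _ y (.fo a :: .rel [a, b] :: Γ)).trans
      (congrArg (Prod.mk y) ((Assignment.read_cons_fo _ x (.rel [a, b] :: Γ)).trans
        (congrArg (Prod.mk x) (ρ.read_cons_rel S Γ)))))
    (by
      intro v hv
      simp [vars, Kind.toVar] at hv ⊢
      tauto) hF (fun M e => {x | X M e x.1 x.2.1}) (fun M x => rank M x.1 x.2.1)
    (fun M e S x h => hX M e S x.1 x.2.1 fun x' y' h' => h (Tuple.mk2 x' y') h')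
    (DefArgs.mk2 ht hu)

/-- Recursive definition of a ternary relation, in the form of `partialFix_eq_of_rank`. -/
theorem DefP.rec₃
    {F : ∀ M : Model L, M.Env Γ → Set (Tuple M.carrier [a, b, c]) → M.D a → M.D b → M.D c → Prop}
    (X : ∀ M : Model L, M.Env Γ → M.D a → M.D b → M.D c → Prop)
    (rank : ∀ M : Model L, M.D a → M.D b → M.D c → ℕ)
    (hX : ∀ M e (S : Set (Tuple M.carrier [a, b, c])) x y z,
      (∀ x' y' z', rank M x' y' z' < rank M x y z →
        (Tuple.mk3 x' y' z' ∈ S ↔ X M e x' y' z')) →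
      (F M e S x y z ↔ X M e x y z))
    (hF : DefP (.fo c :: .fo b :: .fo a :: .rel [a, b, c] :: Γ)
      fun M e => F M e.2.2.2.2 e.2.2.2.1 e.2.2.1 e.2.1 e.1)
    (ht : DefT Γ t) (hu : DefT Γ u) (hv : DefT Γ v) :
    DefP Γ fun M e => X M e (t M e) (u M e) (v M e) :=
  DefP.of_pfp (Θ := .fo c :: .fo b :: .fo a :: .rel [a, b, c] :: Γ)
    [(a, Γ.length + 1), (b, Γ.length + 2), (c, Γ.length + 3)]
    (by simp) (fun e S x => (x.2.2.1, x.2.1, x.1, S, e))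
    (fun ρ S ⟨x, y, z, _⟩ =>
      (Assignment.read_cons_fo _ z (.fo b :: .fo a :: .rel [a, b, c] :: Γ)).trans (congrArg
        (Prod.mk z) ((Assignment.read_cons_fo _ y (.fo a :: .rel [a, b, c] :: Γ)).trans
      (congrArg (Prod.mk y) ((Assignment.read_cons_fo _ x (.rel [a, b, c] :: Γ)).trans
        (congrArg (Prod.mk x) (ρ.read_cons_rel S Γ)))))))
    (by
      intro v hv
      simp [vars, Kind.toVar] at hv ⊢
      tauto) hF (fun M e => {x | X M e x.1 x.2.1 x.2.2.1})
    (fun M x => rank M x.1 x.2.1 x.2.2.1)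
    (fun M e S x h => hX M e S x.1 x.2.1 x.2.2.1 fun x' y' z' h' => h (Tuple.mk3 x' y' z') h')
    (DefArgs.mk3 ht hu hv)

/-- Recursive definition of a quaternary relation, in the form of `partialFix_eq_of_rank`. -/
theorem DefP.rec₄
    {F : ∀ M : Model L, M.Env Γ → Set (Tuple M.carrier [a, b, c, d]) → M.D a → M.D b → M.D c → M.D d → Prop}
    (X : ∀ M : Model L, M.Env Γ → M.D a → M.D b → M.D c → M.D d → Prop)
    (rank : ∀ M : Model L, M.D a → M.D b → M.D c → M.D d → ℕ)
    (hX : ∀ M e (S : Set (Tuple M.carrier [a, b, c, d])) x y z w,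
      (∀ x' y' z' w', rank M x' y' z' w' < rank M x y z w →
        (Tuple.mk4 x' y' z' w' ∈ S ↔ X M e x' y' z' w')) →
      (F M e S x y z w ↔ X M e x y z w))
    (hF : DefP (.fo d :: .fo c :: .fo b :: .fo a :: .rel [a, b, c, d] :: Γ)
      fun M e => F M e.2.2.2.2.2 e.2.2.2.2.1 e.2.2.2.1 e.2.2.1 e.2.1 e.1)
    (ht : DefT Γ t) (hu : DefT Γ u) (hv : DefT Γ v) (hw : DefT Γ w) :
    DefP Γ fun M e => X M e (t M e) (u M e) (v M e) (w M e) :=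
  DefP.of_pfp (Θ := .fo d :: .fo c :: .fo b :: .fo a :: .rel [a, b, c, d] :: Γ)
    [(a, Γ.length + 1), (b, Γ.length + 2), (c, Γ.length + 3), (d, Γ.length + 4)]
    (by simp) (fun e S x => (x.2.2.2.1, x.2.2.1, x.2.1, x.1, S, e))
    (fun ρ S ⟨x, y, z, w, _⟩ =>
      (Assignment.read_cons_fo _ w (.fo c :: .fo b :: .fo a :: .rel [a, b, c, d] :: Γ)).trans
        (congrArg (Prod.mk w)
      ((Assignment.read_cons_fo _ z (.fo b :: .fo a :: .rel [a, b, c, d] :: Γ)).trans (congrArg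
        (Prod.mk z) ((Assignment.read_cons_fo _ y (.fo a :: .rel [a, b, c, d] :: Γ)).trans
      (congrArg (Prod.mk y) ((Assignment.read_cons_fo _ x (.rel [a, b, c, d] :: Γ)).trans
        (congrArg (Prod.mk x) (ρ.read_cons_rel S Γ)))))))))
    (by
      intro v hv
      simp [vars, Kind.toVar] at hv ⊢
      tauto) hF (fun M e => {x | X M e x.1 x.2.1 x.2.2.1 x.2.2.2.1})
    (fun M x => rank M x.1 x.2.1 x.2.2.1 x.2.2.2.1)
    (fun M e S x h => hX M e S x.1 x.2.1 x.2.2.1 x.2.2.2.1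
      fun x' y' z' w' h' => h (Tuple.mk4 x' y' z' w') h')
    (DefArgs.mk4 ht hu hv hw)

end

end PFPC

namespace PFPC

variable {L : FirstOrder.Language.{0, 0}} {V : Type} {Γ : List Kind} {s : Srt}

/-! ### Arithmetic on the number domain -/

/-- An element of the number domain as a natural number. -/
def numVal (x : Dom V Srt.num) : ℕ := Fin.val (n := Nat.card V + 1) x

theorem numVal_le_card (x : Dom V Srt.num) : numVal x ≤ Nat.card V :=
  Nat.le_of_lt_succ (Fin.is_lt (n := Nat.card V + 1) x)

theorem numVal_inj {x y : Dom V Srt.num} : numVal x = numVal y ↔ x = y :=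
  ⟨fun h => Fin.ext (n := Nat.card V + 1) h, fun h => h ▸ rfl⟩

theorem le_iff_numVal {x y : Dom V Srt.num} : x ≤ y ↔ numVal x ≤ numVal y := Iff.rfl

theorem exists_numVal {m : ℕ} (h : m ≤ Nat.card V) : ∃ x : Dom V Srt.num, numVal x = m :=
  ⟨(⟨m, Nat.lt_succ_of_le h⟩ : Fin (Nat.card V + 1)), rfl⟩

theorem exists_numVal_succ {x : Dom V Srt.num} (h : numVal x ≠ 0) :
    ∃ y : Dom V Srt.num, numVal y + 1 = numVal x := by
  obtain ⟨y, hy⟩ := exists_numVal (V := V) (m := numVal x - 1)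
    (by have := numVal_le_card x; omega)
  exact ⟨y, by omega⟩

section

variable {t u v w : ∀ M : Model L, M.Env Γ → M.D Srt.num}

/-- `0` is the least number. -/
theorem DefP.zero (ht : DefT Γ t) : DefP Γ fun M e => numVal (t M e) = 0 :=
  (DefP.all (P := fun M e y => t M e ≤ y) (.le ht.weak .v0)).congr fun M e => by
    simp only [le_iff_numVal]
    refine ⟨fun h y => by omega, fun h => ?_⟩
    obtain ⟨y, hy⟩ := exists_numVal (V := M.carrier) (Nat.zero_le _)
    have := h y
    omega

/-- The size of the structure is the greatest number. -/
theorem DefP.max (ht : DefT Γ t) : DefP Γ fun M e => numVal (t M e) = Nat.card M.carrier :=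
  (DefP.all (P := fun M e y => y ≤ t M e) (.le .v0 ht.weak)).congr fun M e => by
    simp only [le_iff_numVal]
    refine ⟨fun h y => h ▸ numVal_le_card y, fun h => ?_⟩
    obtain ⟨y, hy⟩ := exists_numVal (V := M.carrier) le_rfl
    have := h y
    have := numVal_le_card (t M e)
    omega

theorem DefP.succ (ht : DefT Γ t) (hu : DefT Γ u) :
    DefP Γ fun M e => numVal (t M e) + 1 = numVal (u M e) :=
  (DefP.and (DefP.le hu ht).neg (DefP.all (P := fun M e y => y ≤ t M e ∨ u M e ≤ y)
    (.or (.le .v0 ht.weak) (.le hu.weak .v0)))).congr fun M e => by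
    simp only [le_iff_numVal]
    refine ⟨fun h => ⟨by omega, fun y => by omega⟩, fun h => ?_⟩
    obtain ⟨y, hy⟩ := exists_numVal (V := M.carrier) (m := numVal (t M e) + 1)
      (by have := numVal_le_card (u M e); omega)
    have := h.2 y
    omega

/-- Equality of two sums of numbers, neither of which need lie in the number domain. The recursion
takes away `1` on both sides, from a summand on the left and a summand on the right. -/
theorem DefP.add_eq_add (ht : DefT Γ t) (hu : DefT Γ u) (hv : DefT Γ v) (hw : DefT Γ w) :
    DefP Γ fun M e => numVal (t M e) + numVal (u M e) = numVal (v M e) + numVal (w M e) := by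
  refine DefP.rec₄ (fun M _ x y z w => numVal x + numVal y = numVal z + numVal w)
    (fun M x _ z _ => numVal x + numVal z) (F := fun M _ S x y z w =>
      (numVal x = 0 ∧ numVal z = 0 ∧ y = w) ∨
      (∃ x', numVal x' + 1 = numVal x ∧ ∃ z', numVal z' + 1 = numVal z ∧
        Tuple.mk4 x' y z' w ∈ S) ∨
      (numVal x = 0 ∧ ∃ z', numVal z' + 1 = numVal z ∧ ∃ y', numVal y' + 1 = numVal y ∧
        Tuple.mk4 x y' z' w ∈ S) ∨
      (numVal z = 0 ∧ ∃ x', numVal x' + 1 = numVal x ∧ ∃ w', numVal w' + 1 = numVal w ∧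
        Tuple.mk4 x' y z w' ∈ S))
    ?_ ?_ ht hu hv hw
  · intro M e S x y z w hS
    constructor
    · rintro (⟨h1, h2, rfl⟩ | ⟨x', hx, z', hz, h⟩ | ⟨h1, z', hz, y', hy, h⟩ |
        ⟨h1, x', hx, w', hw, h⟩)
      · omega
      all_goals
        rw [hS _ _ _ _ (by omega)] at h
        omega
    · intro h
      by_cases hx : numVal x = 0 <;> by_cases hz : numVal z = 0
      · exact Or.inl ⟨hx, hz, numVal_inj.1 (by omega)⟩
      · obtain ⟨z', hz'⟩ := exists_numVal_succ hz
        obtain ⟨y', hy'⟩ := exists_numVal_succ (x := y) (by omega)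
        exact Or.inr (Or.inr (Or.inl ⟨hx, z', hz', y', hy', (hS _ _ _ _ (by omega)).2 (by omega)⟩))
      · obtain ⟨x', hx'⟩ := exists_numVal_succ hx
        obtain ⟨w', hw'⟩ := exists_numVal_succ (x := w) (by omega)
        exact Or.inr (Or.inr (Or.inr ⟨hz, x', hx', w', hw', (hS _ _ _ _ (by omega)).2 (by omega)⟩))
      · obtain ⟨x', hx'⟩ := exists_numVal_succ hx
        obtain ⟨z', hz'⟩ := exists_numVal_succ hz
        exact Or.inr (Or.inl ⟨x', hx', z', hz', (hS _ _ _ _ (by omega)).2 (by omega)⟩)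
  · refine .or (.and (.zero .v3) (.and (.zero .v1) (.eq .v2 .v0))) (.or ?_ (.or ?_ ?_))
    · exact .ex (.and (.succ .v0 .v4) (.ex (.and (.succ .v0 .v3)
        (.mem (.mk4 .v1 .v4 .v0 .v2) IsRelVar.v0.weak.weak.weak.weak.weak.weak))))
    · exact .and (.zero .v3) (.ex (.and (.succ .v0 .v2) (.ex (.and (.succ .v0 .v4)
        (.mem (.mk4 .v5 .v0 .v1 .v2) IsRelVar.v0.weak.weak.weak.weak.weak.weak)))))
    · exact .and (.zero .v1) (.ex (.and (.succ .v0 .v4) (.ex (.and (.succ .v0 .v2)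
        (.mem (.mk4 .v1 .v4 .v3 .v0) IsRelVar.v0.weak.weak.weak.weak.weak.weak)))))

end

/-! ### Counting -/

/-- A family of unary relations that is definable with terms as arguments in every extension of the
context; this is the form in which a definable relation can be used inside other definitions. -/
def DefR₁ {a : Srt} (Γ : List Kind) (R : ∀ M : Model L, M.Env Γ → M.D a → Prop) : Prop :=
  ∀ (Δ : List Kind) (f : Ext Δ Γ) (t : ∀ M : Model L, M.Env Δ → M.D a), DefT Δ t →
    DefP Δ fun M e => R M (f.map e) (t M e)

/-- The analogue of `DefR₁` for binary relations. -/
def DefR₂ {a b : Srt} (Γ : List Kind) (R : ∀ M : Model L, M.Env Γ → M.D a → M.D b → Prop) : Prop :=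
  ∀ (Δ : List Kind) (f : Ext Δ Γ) (t : ∀ M : Model L, M.Env Δ → M.D a)
    (u : ∀ M : Model L, M.Env Δ → M.D b), DefT Δ t → DefT Δ u →
    DefP Δ fun M e => R M (f.map e) (t M e) (u M e)

/-- The analogue of `DefR₁` for ternary relations. -/
def DefR₃ {a b c : Srt} (Γ : List Kind)
    (R : ∀ M : Model L, M.Env Γ → M.D a → M.D b → M.D c → Prop) : Prop :=
  ∀ (Δ : List Kind) (f : Ext Δ Γ) (t : ∀ M : Model L, M.Env Δ → M.D a)
    (u : ∀ M : Model L, M.Env Δ → M.D b) (v : ∀ M : Model L, M.Env Δ → M.D c),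
    DefT Δ t → DefT Δ u → DefT Δ v → DefP Δ fun M e => R M (f.map e) (t M e) (u M e) (v M e)

/-- The elements of the domain of a sort that serve as vertices of graphs: all elements of the
structure, and the numbers less than its size. -/
def IsVtx : {s : Srt} → Dom V s → Prop
  | Srt.elem, _ => True
  | Srt.num, x => numVal x < Nat.card V

theorem DefP.isVtx {t : ∀ M : Model L, M.Env Γ → M.D s} (ht : DefT Γ t) :
    DefP Γ fun M e => IsVtx (t M e) := by
  cases s with
  | elem => exact (DefP.eq ht ht).congr fun M e => by simp [IsVtx]
  | num =>
    refine (DefP.max ht).neg.congr fun M e => ?_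
    have := numVal_le_card (t M e)
    simp only [IsVtx]
    omega

/-- The vertex set of graphs on the domain of a sort. -/
@[ext]
structure Model.Vtx (M : Model L) (s : Srt) : Type where
  val : M.D s
  isVtx : IsVtx val

instance (M : Model L) (s : Srt) : Finite (M.D s) := by
  cases s
  · exact inferInstanceAs (Finite M.carrier)
  · infer_instance

instance (M : Model L) (s : Srt) : Finite (M.Vtx s) :=
  Finite.of_injective Model.Vtx.val fun _ _ => Model.Vtx.ext

noncomputable instance (M : Model L) (s : Srt) : Fintype (M.Vtx s) := Fintype.ofFinite _

noncomputable instance (M : Model L) (s : Srt) : DecidableEq (M.Vtx s) := Classical.decEq _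

/-- All elements of the structure are vertices. -/
def Model.vtxElem (M : Model L) : M.Vtx Srt.elem ≃ M.carrier :=
  ⟨fun x => x.1, fun x => ⟨x, trivial⟩, fun _ => rfl, fun _ => rfl⟩

/-- The vertices among the numbers are those less than the size of the structure. -/
def Model.vtxNum (M : Model L) : M.Vtx Srt.num ≃ Fin (Nat.card M.carrier) :=
  ⟨fun x => ⟨numVal x.1, x.2⟩,
    fun x => ⟨(⟨x.1, x.2.trans (Nat.lt_succ_self _)⟩ : Fin (Nat.card M.carrier + 1)), x.2⟩,
    fun _ => rfl, fun _ => rfl⟩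

theorem Model.card_vtx (M : Model L) (s : Srt) : Nat.card (M.Vtx s) = Nat.card M.carrier := by
  cases s
  · exact Nat.card_congr M.vtxElem
  · rw [Nat.card_congr M.vtxNum, Nat.card_fin]

/-- The number of vertices with a definable property is definable. On elements this is a primitive
of the logic; on numbers the count is obtained by recursion. -/
theorem DefP.card_eq {P : ∀ M : Model L, M.Env Γ → M.D s → Prop} (hP : DefR₁ Γ P)
    {t : ∀ M : Model L, M.Env Γ → M.D Srt.num} (ht : DefT Γ t) :
    DefP Γ fun M e => numVal (t M e) = Nat.card {z : M.Vtx s // P M e z.1} := by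
  cases s with
  | elem =>
    have h := hP (.fo Srt.elem :: Γ) (.cons _ (.refl Γ)) _ .v0
    refine (DefP.eq ht (DefT.count (P := P) h)).congr fun M e => ?_
    rw [← numVal_inj]
    have : Nat.card {z : M.Vtx Srt.elem // P M e z.1} = Nat.card {x : M.carrier // P M e x} :=
      Nat.card_congr (M.vtxElem.subtypeEquiv fun _ => Iff.rfl)
    rw [this]
    rfl
  | num =>
    have key : DefP (.fo Srt.num :: Γ) fun M e' =>
        numVal (t M e'.2) = Set.ncard {z : M.D Srt.num | numVal z < numVal e'.1 ∧ P M e'.2 z} := by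
      refine DefP.rec₂ (Γ := .fo Srt.num :: Γ)
        (fun M e' m k => numVal k = Set.ncard {z : M.D Srt.num | numVal z < numVal m ∧ P M e'.2 z})
        (fun M m _ => numVal m) (F := fun M e S m k =>
          (numVal m = 0 ∧ numVal k = 0) ∨
          ∃ m', numVal m' + 1 = numVal m ∧
            ((¬ P M e.2 m' ∧ Tuple.mk2 m' k ∈ S) ∨
            (P M e.2 m' ∧ ∃ k', numVal k' + 1 = numVal k ∧ Tuple.mk2 m' k' ∈ S)))
        ?_ ?_ .v0 ht.weak
      · intro M e S m k hS
        have hstep : ∀ m' : M.D Srt.num, numVal m' + 1 = numVal m →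
            ((P M e.2 m' → Set.ncard {z : M.D Srt.num | numVal z < numVal m ∧ P M e.2 z} =
              Set.ncard {z : M.D Srt.num | numVal z < numVal m' ∧ P M e.2 z} + 1) ∧
            (¬ P M e.2 m' → Set.ncard {z : M.D Srt.num | numVal z < numVal m ∧ P M e.2 z} =
              Set.ncard {z : M.D Srt.num | numVal z < numVal m' ∧ P M e.2 z})) := by
          intro m' hm'
          have hlt : ∀ z : M.D Srt.num, numVal z < numVal m ↔ z = m' ∨ numVal z < numVal m' := by
            intro z
            rw [← numVal_inj]
            omega
          constructor
          · intro h
            rw [← Set.ncard_insert_of_notMem (a := m') (by simp) (Set.toFinite _)]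
            congr 1
            ext z
            simp only [Set.mem_insert_iff, Set.mem_ofPred_eq, hlt]
            constructor
            · rintro ⟨h1 | h1, h2⟩
              exacts [Or.inl h1, Or.inr ⟨h1, h2⟩]
            · rintro (rfl | ⟨h1, h2⟩)
              exacts [⟨Or.inl rfl, h⟩, ⟨Or.inr h1, h2⟩]
          · intro h
            congr 1
            ext z
            simp only [Set.mem_ofPred_eq, hlt]
            constructor
            · rintro ⟨rfl | h1, h2⟩
              exacts [absurd h2 h, ⟨h1, h2⟩]
            · rintro ⟨h1, h2⟩
              exact ⟨Or.inr h1, h2⟩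
        constructor
        · rintro (⟨h1, h2⟩ | ⟨m', hm', ⟨hp, h⟩ | ⟨hp, k', hk', h⟩⟩)
          · simp [h1, h2]
          · rw [(hstep m' hm').2 hp, ← hS _ _ (by omega)]
            exact h
          · rw [(hstep m' hm').1 hp, ← hk', Nat.add_right_cancel_iff, ← hS _ _ (by omega)]
            exact h
        · intro h
          by_cases hm : numVal m = 0
          · exact Or.inl ⟨hm, by simpa [hm] using h⟩
          · obtain ⟨m', hm'⟩ := exists_numVal_succ hm
            refine Or.inr ⟨m', hm', ?_⟩
            by_cases hp : P M e.2 m'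
            · rw [(hstep m' hm').1 hp] at h
              obtain ⟨k', hk'⟩ := exists_numVal_succ (x := k) (by omega)
              exact Or.inr ⟨hp, k', hk', (hS _ _ (by omega)).2 (by omega)⟩
            · rw [(hstep m' hm').2 hp] at h
              exact Or.inl ⟨hp, (hS _ _ (by omega)).2 h⟩
      · have hP' := hP _ (.cons (.fo Srt.num) (.cons (.fo Srt.num) (.cons (.fo Srt.num)
          (.cons (.rel [Srt.num, Srt.num]) (.cons (.fo Srt.num) (.refl Γ)))))) _ .v0
        exact .or (.and (.zero .v1) (.zero .v0)) (.ex (.and (.succ .v0 .v2)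
          (.or (.and hP'.neg (.mem (.mk2 .v0 .v1) IsRelVar.v0.weak.weak.weak))
            (.and hP' (.ex (.and (.succ .v0 .v2)
              (.mem (.mk2 .v1 .v0) IsRelVar.v0.weak.weak.weak.weak)))))))
    refine (DefP.ex (P := fun M e m => numVal m = Nat.card M.carrier ∧
      numVal (t M e) = Set.ncard {z : M.D Srt.num | numVal z < numVal m ∧ P M e z})
      (.and (.max .v0) key)).congr fun M e => ?_
    have : Nat.card {z : M.Vtx Srt.num // P M e z.1} =
        Set.ncard {z : M.D Srt.num | numVal z < Nat.card M.carrier ∧ P M e z} := by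
      rw [← Nat.card_coe_set_eq]
      exact Nat.card_congr ⟨fun z => ⟨z.1.1, z.1.2, z.2⟩, fun z => ⟨⟨z.1, z.2.1⟩, z.2.2⟩,
        fun _ => rfl, fun _ => rfl⟩
    rw [this]
    constructor
    · intro h
      obtain ⟨m, hm⟩ := exists_numVal (V := M.carrier) le_rfl
      exact ⟨m, hm, by rw [hm]; exact h⟩
    · rintro ⟨m, hm, h⟩
      rw [hm] at h
      exact h

end PFPC

namespace PFPC

variable {L : FirstOrder.Language.{0, 0}} {V : Type} {Γ : List Kind} {s : Srt}

/-! ### Large numbers in binary -/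

/-- A pair of numbers as a position in a binary expansion. -/
noncomputable def pos (i j : Dom V Srt.num) : ℕ := numVal i * (Nat.card V + 1) + numVal j

theorem pos_lt (i j : Dom V Srt.num) : pos i j < (Nat.card V + 1) * (Nat.card V + 1) := by
  have hi := numVal_le_card i
  have hj := numVal_le_card j
  unfold pos
  nlinarith [Nat.mul_le_mul_right (Nat.card V + 1) hi]

theorem pos_inj {i j i' j' : Dom V Srt.num} : pos i j = pos i' j' ↔ i = i' ∧ j = j' := by
  refine ⟨fun h => ?_, by rintro ⟨rfl, rfl⟩; rfl⟩
  have hj := Nat.lt_succ_of_le (numVal_le_card j)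
  have hj' := Nat.lt_succ_of_le (numVal_le_card j')
  have h1 := congrArg (· / (Nat.card V + 1)) h
  have h2 := congrArg (· % (Nat.card V + 1)) h
  simp only [pos, Nat.mul_add_mod_of_lt hj, Nat.mul_add_mod_of_lt hj'] at h2
  simp only [pos, Nat.mul_comm _ (Nat.card V + 1), Nat.mul_add_div (Nat.succ_pos _),
    Nat.div_eq_of_lt hj, Nat.div_eq_of_lt hj', add_zero] at h1
  exact ⟨numVal_inj.1 h1, numVal_inj.1 h2⟩

theorem exists_pos {p : ℕ} (h : p < (Nat.card V + 1) * (Nat.card V + 1)) :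
    ∃ i j : Dom V Srt.num, pos i j = p := by
  obtain ⟨i, hi⟩ := exists_numVal (V := V) (m := p / (Nat.card V + 1))
    (Nat.le_of_lt_succ (Nat.div_lt_of_lt_mul h))
  obtain ⟨j, hj⟩ := exists_numVal (V := V) (m := p % (Nat.card V + 1))
    (Nat.le_of_lt_succ (Nat.mod_lt _ (Nat.succ_pos _)))
  exact ⟨i, j, by rw [pos, hi, hj, Nat.div_add_mod']⟩

theorem pos_eq_zero_iff {i j : Dom V Srt.num} : pos i j = 0 ↔ numVal i = 0 ∧ numVal j = 0 := by
  simp [pos]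

theorem pos_succ_iff {i j i' j' : Dom V Srt.num} : pos i j + 1 = pos i' j' ↔
    (i = i' ∧ numVal j + 1 = numVal j') ∨
      (numVal i + 1 = numVal i' ∧ numVal j = Nat.card V ∧ numVal j' = 0) := by
  constructor
  · intro h
    rcases (numVal_le_card j).lt_or_eq with hj | hj
    · obtain ⟨k, hk⟩ := exists_numVal (V := V) (m := numVal j + 1) hj
      have : pos i k = pos i' j' := by rw [← h, pos, pos, hk, add_assoc]
      obtain ⟨rfl, rfl⟩ := pos_inj.1 this
      exact Or.inl ⟨rfl, hk.symm⟩
    · have hi : numVal i + 1 ≤ Nat.card V := by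
        by_contra hi
        have h1 := numVal_le_card i
        have h2 : numVal i = Nat.card V := by omega
        have := pos_lt i' j'
        rw [← h, pos, h2, hj] at this
        nlinarith
      obtain ⟨k, hk⟩ := exists_numVal (V := V) hi
      obtain ⟨z, hz⟩ := exists_numVal (V := V) (Nat.zero_le _)
      have : pos k z = pos i' j' := by rw [← h, pos, pos, hk, hj, hz]; ring
      obtain ⟨rfl, rfl⟩ := pos_inj.1 this
      exact Or.inr ⟨hk.symm, hj, hz⟩
  · rintro (⟨rfl, h⟩ | ⟨h1, h2, h3⟩)
    · rw [pos, pos, ← h, add_assoc]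
    · rw [pos, pos, ← h1, h2, h3]; ring

theorem DefP.pos_succ {t u v w : ∀ M : Model L, M.Env Γ → M.D Srt.num} (ht : DefT Γ t)
    (hu : DefT Γ u) (hv : DefT Γ v) (hw : DefT Γ w) :
    DefP Γ fun M e => pos (t M e) (u M e) + 1 = pos (v M e) (w M e) :=
  (DefP.or (.and (.eq ht hv) (.succ hu hw))
    (.and (.succ ht hv) (.and (.max hu) (.zero hw)))).congr fun _ _ => pos_succ_iff

/-- The number with digit `1` at the position of `(i, j)` if and only if `B i j`. -/
noncomputable def bitNum (B : Dom V Srt.num → Dom V Srt.num → Prop) : ℕ :=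
  open Classical in
  Nat.ofBits fun p : Fin ((Nat.card V + 1) * (Nat.card V + 1)) => decide (∃ i j, pos i j = p ∧ B i j)

theorem testBit_bitNum (B : Dom V Srt.num → Dom V Srt.num → Prop) (i j : Dom V Srt.num) :
    (bitNum B).testBit (pos i j) ↔ B i j := by
  classical
  rw [bitNum, Nat.testBit_ofBits_lt _ _ (pos_lt i j), decide_eq_true_iff]
  constructor
  · rintro ⟨i', j', h, hB⟩
    obtain ⟨rfl, rfl⟩ := pos_inj.1 h
    exact hB
  · exact fun h => ⟨i, j, rfl, h⟩

theorem bitNum_eq_mod {B : Dom V Srt.num → Dom V Srt.num → Prop} {f : ℕ}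
    (h : ∀ i j, B i j ↔ f.testBit (pos i j)) :
    bitNum B = f % 2 ^ ((Nat.card V + 1) * (Nat.card V + 1)) := by
  refine Nat.eq_of_testBit_eq fun p => ?_
  rw [Nat.testBit_mod_two_pow]
  by_cases hp : p < (Nat.card V + 1) * (Nat.card V + 1)
  · obtain ⟨i, j, rfl⟩ := exists_pos hp
    have := (testBit_bitNum B i j).trans (h i j)
    simp only [hp, decide_true, Bool.true_and]
    exact Bool.eq_iff_iff.2 this
  · rw [bitNum, Nat.testBit_ofBits_ge _ _ (not_lt.1 hp)]
    simp [hp]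

/-- Binary digits of a sum at the positions given by pairs do not depend on the digits of the
summands at other positions. -/
theorem testBit_sum_bitNum {ι : Type} [Fintype ι] {B : ι → Dom V Srt.num → Dom V Srt.num → Prop}
    {f : ι → ℕ} (h : ∀ z i j, B z i j ↔ (f z).testBit (pos i j)) (i j : Dom V Srt.num) :
    (∑ z, bitNum (B z)).testBit (pos i j) = (∑ z, f z).testBit (pos i j) := by
  have h1 : (∑ z, bitNum (B z)) % 2 ^ ((Nat.card V + 1) * (Nat.card V + 1)) =
      (∑ z, f z) % 2 ^ ((Nat.card V + 1) * (Nat.card V + 1)) := by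
    rw [Finset.sum_nat_mod, Finset.sum_nat_mod _ _ f]
    simp only [bitNum_eq_mod (h _), Nat.mod_mod]
  have h2 := congrArg (Nat.testBit · (pos i j)) h1
  simpa only [Nat.testBit_mod_two_pow, pos_lt, decide_true, Bool.true_and] using h2

/-- The carry into position `p` when the numbers `f z` are added in binary. -/
def carry {ι : Type} [Fintype ι] (f : ι → ℕ) (p : ℕ) : ℕ := (∑ z, f z % 2 ^ p) / 2 ^ p

section

variable {ι : Type} [Fintype ι] (f : ι → ℕ)

theorem carry_zero : carry f 0 = 0 := by simp [carry, Nat.mod_one]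

theorem carry_le (p : ℕ) : carry f p ≤ Nat.card ι := by
  have hp : 0 < 2 ^ p := by positivity
  rw [carry, Nat.card_eq_fintype_card]
  refine Nat.div_le_of_le_mul ?_
  calc ∑ z, f z % 2 ^ p ≤ ∑ _z : ι, 2 ^ p := Finset.sum_le_sum fun z _ => (Nat.mod_lt _ hp).le
    _ = 2 ^ p * Fintype.card ι := by simp [mul_comm]

theorem sum_mod_two_pow_succ (p : ℕ) : ∑ z, f z % 2 ^ (p + 1) =
    ∑ z, f z % 2 ^ p + 2 ^ p * Nat.card {z // (f z).testBit p} := by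
  simp only [Nat.mod_pow_succ, Finset.sum_add_distrib, ← Finset.mul_sum]
  congr 2
  rw [Nat.card_eq_fintype_card, Fintype.card_subtype, Finset.card_filter]
  refine Finset.sum_congr rfl fun z _ => ?_
  rw [Nat.testBit_eq_decide_div_mod_eq]
  rcases Nat.mod_two_eq_zero_or_one (f z / 2 ^ p) with h | h <;> simp [h]

theorem carry_add (p : ℕ) : carry f p + Nat.card {z // (f z).testBit p} =
    (∑ z, f z % 2 ^ (p + 1)) / 2 ^ p := by
  rw [sum_mod_two_pow_succ, Nat.add_mul_div_left _ _ (by positivity), carry]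

theorem carry_succ (p : ℕ) :
    carry f (p + 1) = (carry f p + Nat.card {z // (f z).testBit p}) / 2 := by
  rw [carry_add, Nat.div_div_eq_div_mul, ← pow_succ, carry]

theorem testBit_sum (p : ℕ) : (∑ z, f z).testBit p ↔
    (carry f p + Nat.card {z // (f z).testBit p}) % 2 = 1 := by
  have h := Nat.testBit_mod_two_pow (∑ z, f z) (p + 1) p
  rw [Finset.sum_nat_mod, Nat.testBit_mod_two_pow] at h
  simp only [Nat.lt_succ_self, decide_true, Bool.true_and] at h
  rw [carry_add, ← h, Nat.testBit_eq_decide_div_mod_eq, decide_eq_true_iff]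

end

/-- If the binary digits of a family of numbers indexed by vertices are definable, then so are those
of their sum. The carries, which are at most the number of summands, are defined by recursion on the
position. -/
theorem DefP.testBit_sum
    {B : ∀ M : Model L, M.Env Γ → M.D s → M.D Srt.num → M.D Srt.num → Prop} (hB : DefR₃ Γ B)
    {t u : ∀ M : Model L, M.Env Γ → M.D Srt.num} (ht : DefT Γ t) (hu : DefT Γ u) :
    DefP Γ fun M e => (∑ z : M.Vtx s, bitNum (B M e z.1)).testBit (pos (t M e) (u M e)) := by
  have hcount : ∀ {Δ : List Kind} (f : Ext Δ Γ) {i j d : ∀ M : Model L, M.Env Δ → M.D Srt.num},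
      DefT Δ i → DefT Δ j → DefT Δ d → DefP Δ fun M e => numVal (d M e) =
        Nat.card {z : M.Vtx s // B M (f.map e) z.1 (i M e) (j M e)} := fun f _ _ _ hi hj hd =>
    DefP.card_eq (P := fun M e z => B M (f.map e) z _ _)
      (fun _ g _ hz => hB _ (f.comp g) _ _ _ hz (hi.ext g) (hj.ext g)) hd
  have hcarry : ∀ {Δ : List Kind} (f : Ext Δ Γ) {i j c : ∀ M : Model L, M.Env Δ → M.D Srt.num},
      DefT Δ i → DefT Δ j → DefT Δ c → DefP Δ fun M e => numVal (c M e) =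
        carry (fun z : M.Vtx s => bitNum (B M (f.map e) z.1)) (pos (i M e) (j M e)) := by
    intro Δ f i j c hi hj hc
    refine DefP.rec₃ (Γ := Δ) (fun M e i j c => numVal c =
        carry (fun z : M.Vtx s => bitNum (B M (f.map e) z.1)) (pos i j))
      (fun M i j _ => pos i j) (F := fun M e S i j c =>
        -- The number `c` is `(c' + d) / 2`, rounded down, where `c'` is the carry into the preceding
        -- position and `d` is the number of summands with digit `1` there.
        ((numVal i = 0 ∧ numVal j = 0) ∧ numVal c = 0) ∨
        ∃ i' j', pos i' j' + 1 = pos i j ∧ ∃ c', Tuple.mk3 i' j' c' ∈ S ∧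
          ∃ d : M.D Srt.num, numVal d = Nat.card {z : M.Vtx s // B M (f.map e) z.1 i' j'} ∧
            (numVal c' + numVal d = numVal c + numVal c ∨
              ∃ r : M.D Srt.num, numVal c + 1 = numVal r ∧ numVal c' + numVal d = numVal c + numVal r))
      ?_ ?_ hi hj hc
    · intro M e S i j c hS
      have hstep : ∀ i' j', pos i' j' + 1 = pos i j →
          carry (fun z : M.Vtx s => bitNum (B M (f.map e) z.1)) (pos i j) =
          (carry (fun z : M.Vtx s => bitNum (B M (f.map e) z.1)) (pos i' j') +
            Nat.card {z : M.Vtx s // B M (f.map e) z.1 i' j'}) / 2 := by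
        intro i' j' h
        rw [← h, carry_succ]
        simp only [testBit_bitNum]
      constructor
      · rintro (⟨h1, h2⟩ | ⟨i', j', h, c', hc', d, hd, h'⟩)
        · rw [pos_eq_zero_iff.2 h1, h2, carry_zero]
        · rw [hS _ _ _ (by omega)] at hc'
          rw [hstep _ _ h, ← hc', ← hd]
          rcases h' with h' | ⟨r, hr, h'⟩ <;> omega
      · intro hc
        by_cases h0 : pos i j = 0
        · exact Or.inl ⟨pos_eq_zero_iff.1 h0, by rw [hc, h0, carry_zero]⟩
        · obtain ⟨i', j', h'⟩ := exists_pos (V := M.carrier) (p := pos i j - 1)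
            (by have := pos_lt i j; omega)
          have h : pos i' j' + 1 = pos i j := by omega
          rw [hstep _ _ h] at hc
          obtain ⟨c', hc'⟩ := exists_numVal (V := M.carrier)
            ((carry_le (fun z : M.Vtx s => bitNum (B M (f.map e) z.1)) (pos i' j')).trans
              (M.card_vtx s).le)
          obtain ⟨d, hd⟩ := exists_numVal (V := M.carrier)
            ((Finite.card_subtype_le fun z : M.Vtx s => B M (f.map e) z.1 i' j').trans
              (M.card_vtx s).le)
          refine Or.inr ⟨i', j', h, c', (hS _ _ _ (by omega)).2 hc', d, hd, ?_⟩
          rw [← hc', ← hd] at hc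
          rcases Nat.mod_two_eq_zero_or_one (numVal c' + numVal d) with h2 | h2
          · left; omega
          · right
            obtain ⟨r, hr⟩ := exists_numVal (V := M.carrier) (m := numVal c + 1) (by
              have := numVal_le_card c'
              have := numVal_le_card d
              omega)
            exact ⟨r, hr.symm, by omega⟩
    · refine .or (.and (.and (.zero .v2) (.zero .v1)) (.zero .v0)) (.ex (.ex (.and
        (.pos_succ .v1 .v0 .v4 .v3) (.ex (.and
          (.mem (.mk3 .v2 .v1 .v0) IsRelVar.v0.weak.weak.weak.weak.weak.weak)
          (.ex (.and (hcount (f.comp (.cons _ (.cons _ (.cons _ (.cons _ (.cons _ (.cons _ (.cons _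
            (.cons _ (.refl Δ)))))))))) .v3 .v2 .v0) (.or (.add_eq_add .v1 .v0 .v4 .v4)
            (.ex (.and (.succ .v5 .v0) (.add_eq_add .v2 .v1 .v5 .v0)))))))))))
  -- The digit of the sum is `1` if and only if the sum of the carry `c` and the number `d` of
  -- digits `1` is odd, that is, of the form `q + (q + 1)`.
  refine (DefP.ex (P := fun M e c => numVal c =
      carry (fun z : M.Vtx s => bitNum (B M e z.1)) (pos (t M e) (u M e)) ∧
    ∃ d : M.D Srt.num, numVal d = Nat.card {z : M.Vtx s // B M e z.1 (t M e) (u M e)} ∧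
    ∃ q r : M.D Srt.num, numVal q + 1 = numVal r ∧ numVal c + numVal d = numVal q + numVal r)
    (.and (hcarry (.cons _ (.refl Γ)) ht.weak hu.weak .v0)
      (.ex (.and (hcount (.cons _ (.cons _ (.refl Γ))) ht.weak.weak hu.weak.weak .v0)
        (.ex (.ex (.and (.succ .v1 .v0) (.add_eq_add .v3 .v2 .v1 .v0)))))))).congr fun M e => ?_
  rw [PFPC.testBit_sum]
  simp only [testBit_bitNum]
  constructor
  · intro h
    obtain ⟨c, hc⟩ := exists_numVal (V := M.carrier)
      ((carry_le (fun z : M.Vtx s => bitNum (B M e z.1)) (pos (t M e) (u M e))).trans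
        (M.card_vtx s).le)
    obtain ⟨d, hd⟩ := exists_numVal (V := M.carrier)
      ((Finite.card_subtype_le fun z : M.Vtx s => B M e z.1 (t M e) (u M e)).trans
        (M.card_vtx s).le)
    rw [← hc, ← hd] at h
    have h1 := numVal_le_card c
    have h2 := numVal_le_card d
    obtain ⟨q, hq⟩ := exists_numVal (V := M.carrier) (m := (numVal c + numVal d) / 2) (by omega)
    obtain ⟨r, hr⟩ := exists_numVal (V := M.carrier) (m := (numVal c + numVal d) / 2 + 1) (by omega)
    exact ⟨c, hc, d, hd, q, r, by omega, by omega⟩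
  · rintro ⟨c, hc, d, hd, q, r, hqr, h⟩
    rw [← hc, ← hd]
    omega

/-! ### Powers of the adjacency matrix -/

/-- The adjacency matrix of a relation on the vertices in a domain. -/
noncomputable def adjMat (M : Model L) {s : Srt} (R : M.D s → M.D s → Prop) :
    Matrix (M.Vtx s) (M.Vtx s) ℕ :=
  open Classical in Matrix.of fun y z => if R y.1 z.1 then 1 else 0

/-- The binary digits of the entries of the powers of a definable adjacency matrix are definable, by
recursion on the exponent. -/
theorem DefP.testBit_pow {R : ∀ M : Model L, M.Env Γ → M.D s → M.D s → Prop} (hR : DefR₂ Γ R)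
    {x y : ∀ M : Model L, M.Env Γ → M.D s} {k t u : ∀ M : Model L, M.Env Γ → M.D Srt.num}
    (hx : DefT Γ x) (hk : DefT Γ k) (hy : DefT Γ y) (ht : DefT Γ t) (hu : DefT Γ u) :
    DefP Γ fun M e => ∃ (hx : IsVtx (x M e)) (hy : IsVtx (y M e)),
      ((adjMat M (R M e) ^ numVal (k M e)) ⟨y M e, hy⟩ ⟨x M e, hx⟩).testBit
        (pos (t M e) (u M e)) := by
  refine DefP.rec₄ (Γ := Γ) (fun M e k y i j => ∃ (hx : IsVtx (x M e)) (hy : IsVtx y),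
      ((adjMat M (R M e) ^ numVal k) ⟨y, hy⟩ ⟨x M e, hx⟩).testBit (pos i j))
    (fun M k _ _ _ => numVal k) (F := fun M e S k y i j =>
      IsVtx (x M e) ∧ IsVtx y ∧
      ((numVal k = 0 ∧ y = x M e ∧ numVal i = 0 ∧ numVal j = 0) ∨
      ∃ k', numVal k' + 1 = numVal k ∧
        (∑ z : M.Vtx s, bitNum fun i j => R M e y z.1 ∧ Tuple.mk4 k' z.1 i j ∈ S).testBit (pos i j)))
    ?_ ?_ hk hy ht hu
  · intro M e S k y i j hS
    have hiff : ∀ (hx : IsVtx (x M e)) (hy : IsVtx y),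
        ((numVal k = 0 ∧ y = x M e ∧ numVal i = 0 ∧ numVal j = 0) ∨
        ∃ k', numVal k' + 1 = numVal k ∧
          (∑ z : M.Vtx s, bitNum fun i j => R M e y z.1 ∧ Tuple.mk4 k' z.1 i j ∈ S).testBit
            (pos i j)) ↔
        ((adjMat M (R M e) ^ numVal k) ⟨y, hy⟩ ⟨x M e, hx⟩).testBit (pos i j) := by
      intro hx hy
      by_cases hk : numVal k = 0
      · have h1 : ¬ ∃ k', numVal k' + 1 = numVal k ∧ (∑ z : M.Vtx s, bitNum fun i j =>
            R M e y z.1 ∧ Tuple.mk4 k' z.1 i j ∈ S).testBit (pos i j) := by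
          rintro ⟨k', hk', -⟩
          omega
        rw [hk, pow_zero, Matrix.one_apply, or_iff_left (hk ▸ h1)]
        have h2 : ((⟨y, hy⟩ : M.Vtx s) = ⟨x M e, hx⟩) ↔ y = x M e :=
          Model.Vtx.ext_iff
        by_cases h : y = x M e
        · rw [if_pos (h2.2 h), Nat.testBit_one_eq_true_iff_self_eq_zero, pos_eq_zero_iff]
          simp [h]
        · rw [if_neg (fun h' => h (h2.1 h'))]
          simp [h]
      · have key : ∀ k', numVal k' + 1 = numVal k → ((∑ z : M.Vtx s, bitNum fun i j =>
            R M e y z.1 ∧ Tuple.mk4 k' z.1 i j ∈ S).testBit (pos i j) =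
            ((adjMat M (R M e) ^ numVal k) ⟨y, hy⟩ ⟨x M e, hx⟩).testBit (pos i j)) := by
          intro k' hk'
          rw [← hk', pow_succ', Matrix.mul_apply]
          refine testBit_sum_bitNum (fun z i j => ?_) i j
          rw [hS _ _ _ _ (by omega)]
          by_cases h : R M e y z.1
          · simp only [h, true_and, adjMat, Matrix.of_apply, if_true, one_mul]
            exact ⟨fun ⟨_, _, h⟩ => h, fun h => ⟨hx, z.2, h⟩⟩
          · simp [h, adjMat]
        constructor
        · rintro (h | ⟨k', hk', h⟩)
          · exact absurd h.1 hk
          · rwa [key k' hk'] at h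
        · intro h
          obtain ⟨k', hk'⟩ := exists_numVal_succ hk
          exact Or.inr ⟨k', hk', by rwa [key k' hk']⟩
    constructor
    · rintro ⟨hx, hy, h⟩
      exact ⟨hx, hy, (hiff hx hy).1 h⟩
    · rintro ⟨hx, hy, h⟩
      exact ⟨hx, hy, (hiff hx hy).2 h⟩
  · refine .and (.isVtx hx.weak.weak.weak.weak.weak) (.and (.isVtx .v2) (.or
      (.and (.zero .v3) (.and (.eq .v2 hx.weak.weak.weak.weak.weak) (.and (.zero .v1) (.zero .v0))))
      (.ex (.and (.succ .v0 .v4) ?_))))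
    refine DefP.testBit_sum (Γ := .fo .num :: .fo .num :: .fo .num :: .fo s :: .fo .num ::
      .rel [.num, s, .num, .num] :: Γ) (B := fun M e z i j => R M e.2.2.2.2.2.2 e.2.2.2.1 z ∧
        Tuple.mk4 (a := .num) e.1 z i j ∈
          (show Set (Tuple M.carrier [.num, s, .num, .num]) from e.2.2.2.2.2.1)) ?_ .v2 .v1
    intro Δ f z i j hz hi hj
    exact .and (hR _ (.comp (.cons _ (.cons _ (.cons _ (.cons _ (.cons _ (.cons _ (.refl Γ)))))))
      f) _ _ (DefT.v3.ext f) hz)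
      (.mem (.mk4 (DefT.v0.ext f) hz hi hj) (IsRelVar.v0.weak.weak.weak.weak.weak.ext f))

theorem DefP.testBit_trace_pow {R : ∀ M : Model L, M.Env Γ → M.D s → M.D s → Prop}
    (hR : DefR₂ Γ R) {k t u : ∀ M : Model L, M.Env Γ → M.D Srt.num} (hk : DefT Γ k) (ht : DefT Γ t)
    (hu : DefT Γ u) :
    DefP Γ fun M e => ((adjMat M (R M e) ^ numVal (k M e)).trace).testBit
      (pos (t M e) (u M e)) := by
  refine (DefP.testBit_sum (s := s) (B := fun M e x i j =>
    ∃ (hx : IsVtx x) (hy : IsVtx x),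
      ((adjMat M (R M e) ^ numVal (k M e)) ⟨x, hy⟩ ⟨x, hx⟩).testBit (pos i j)) ?_ ht hu).congr
    fun M e => ?_
  · intro Δ f x i j hx hi hj
    exact DefP.testBit_pow (R := fun M e => R M (f.map e))
      (fun Θ g y z hy hz => hR Θ (f.comp g) y z hy hz) hx (hk.ext f) hx hi hj
  · rw [testBit_sum_bitNum (f := fun x => (adjMat M (R M e) ^ numVal (k M e)) x x)]
    · rfl
    · intro x i j
      exact ⟨fun ⟨_, _, h⟩ => h, fun h => ⟨x.2, x.2, h⟩⟩

end PFPC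

/-! ### Spectra and traces of powers -/

namespace GraphSpectrum

open Polynomial

theorem trace_pow_eq_sum {n : Type*} [Fintype n] [DecidableEq n] {A : Matrix n n ℝ}
    (hA : A.IsHermitian) (k : ℕ) : (A ^ k).trace = ∑ i, hA.eigenvalues i ^ k := by
  conv_lhs => rw [hA.spectral_theorem, ← map_pow, Unitary.conjStarAlgAut_apply,
    Matrix.trace_mul_cycle, Unitary.coe_star_mul_self, one_mul, Matrix.diagonal_pow,
    Matrix.trace_diagonal]
  rfl

/-- By Newton's identities, the power sums of two families of the same size up to this size
determine their elementary symmetric functions. -/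
theorem aeval_esymm_eq_of_psum_eq {ι κ : Type*} [Fintype ι] [Fintype κ]
    {f : ι → ℝ} {g : κ → ℝ} {n : ℕ} (h : ∀ k ≤ n, ∑ i, f i ^ k = ∑ i, g i ^ k) :
    ∀ k ≤ n, MvPolynomial.aeval f (MvPolynomial.esymm ι ℝ k) =
      MvPolynomial.aeval g (MvPolynomial.esymm κ ℝ k) := by
  intro k
  induction k using Nat.strong_induction_on with
  | _ k ih =>
    intro hk
    rcases Nat.eq_zero_or_pos k with rfl | hpos
    · simp
    · have hk0 : (k : ℝ) ≠ 0 := by positivity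
      have h1 := congrArg (MvPolynomial.aeval f) (MvPolynomial.mul_esymm_eq_sum ι ℝ k)
      have h2 := congrArg (MvPolynomial.aeval g) (MvPolynomial.mul_esymm_eq_sum κ ℝ k)
      simp only [map_mul, map_natCast, map_sum, map_pow, map_neg, map_one] at h1 h2
      refine mul_left_cancel₀ hk0 (h1.trans (Eq.trans ?_ h2.symm))
      congr 1
      refine Finset.sum_congr rfl fun a ha => ?_
      rw [Finset.mem_filter, Finset.HasAntidiagonal.mem_antidiagonal] at ha
      rw [ih a.1 ha.2 (by omega)]
      congr 1
      simpa [MvPolynomial.psum] using h a.2 (by omega)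

theorem prod_X_sub_C_eq_of_psum_eq {ι κ : Type*} [Fintype ι] [Fintype κ]
    {f : ι → ℝ} {g : κ → ℝ} (hc : Fintype.card ι = Fintype.card κ)
    (h : ∀ k ≤ Fintype.card ι, ∑ i, f i ^ k = ∑ i, g i ^ k) :
    ∏ i, (X - C (f i)) = ∏ i, (X - C (g i)) := by
  have h1 := Multiset.prod_X_sub_X_eq_sum_esymm (Finset.univ.val.map f)
  have h2 := Multiset.prod_X_sub_X_eq_sum_esymm (Finset.univ.val.map g)
  rw [Multiset.map_map] at h1 h2
  refine h1.trans (Eq.trans ?_ h2.symm)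
  simp only [Multiset.card_map, Finset.card_val, Finset.card_univ, ← hc]
  refine Finset.sum_congr rfl fun k hk => ?_
  have := aeval_esymm_eq_of_psum_eq h k (Nat.le_of_lt_succ (Finset.mem_range.1 hk))
  rw [MvPolynomial.aeval_esymm_eq_multiset_esymm, MvPolynomial.aeval_esymm_eq_multiset_esymm] at this
  rw [this]

section

variable {V W : Type} [Fintype V] [Fintype W]

theorem card_spec (G : SimpleGraph V) : Multiset.card (spec G) = Fintype.card V := by
  classical
  have h := (G.isHermitian_adjMatrix ℝ).roots_charpoly_eq_eigenvalues
  have : spec G = (G.adjMatrix ℝ).charpoly.roots := by unfold spec; congr!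
  rw [this, h]
  simp

theorem trace_adjMatrix_pow_natCast [DecidableEq V] (G : SimpleGraph V) [DecidableRel G.Adj] (k : ℕ) :
    (((G.adjMatrix ℕ ^ k).trace : ℕ) : ℝ) = (G.adjMatrix ℝ ^ k).trace := by
  have h : G.adjMatrix ℝ = (Nat.castRingHom ℝ).mapMatrix (G.adjMatrix ℕ) := by
    ext i j
    simp [SimpleGraph.adjMatrix_apply]
  rw [h, ← map_pow]
  simp [Matrix.trace]

/-- Two graphs on the same number `n` of vertices have the same spectrum if and only if they have
the same number of closed walks of every length up to `n`. -/
theorem spec_eq_spec_iff [DecidableEq V] [DecidableEq W] (G : SimpleGraph V) (H : SimpleGraph W)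
    [DecidableRel G.Adj] [DecidableRel H.Adj] (hc : Fintype.card V = Fintype.card W) :
    spec G = spec H ↔ ∀ k ≤ Fintype.card V,
      (G.adjMatrix ℕ ^ k).trace = (H.adjMatrix ℕ ^ k).trace := by
  have hG := G.isHermitian_adjMatrix ℝ
  have hH := H.isHermitian_adjMatrix ℝ
  have hsG : spec G = (G.adjMatrix ℝ).charpoly.roots := by unfold spec; congr!
  have hsH : spec H = (H.adjMatrix ℝ).charpoly.roots := by unfold spec; congr!
  have key : ∀ k, (G.adjMatrix ℕ ^ k).trace = (H.adjMatrix ℕ ^ k).trace ↔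
      ∑ i, hG.eigenvalues i ^ k = ∑ i, hH.eigenvalues i ^ k := by
    intro k
    rw [← trace_pow_eq_sum, ← trace_pow_eq_sum, ← trace_adjMatrix_pow_natCast,
      ← trace_adjMatrix_pow_natCast, Nat.cast_inj]
  simp only [key]
  constructor
  · intro h k _
    rw [hsG, hsH, hG.roots_charpoly_eq_eigenvalues, hH.roots_charpoly_eq_eigenvalues] at h
    have := congrArg (fun s => (Multiset.map (fun x => x ^ k) s).sum) h
    simpa [Multiset.map_map] using this
  · intro h
    rw [hsG, hsH, hG.charpoly_eq, hH.charpoly_eq]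
    exact congrArg _ (prod_X_sub_C_eq_of_psum_eq hc h)

theorem spec_eq_of_iso {G : SimpleGraph V} {H : SimpleGraph W} (e : G ≃g H) : spec G = spec H := by
  classical
  have h : H.adjMatrix ℝ = Matrix.reindex e.toEquiv e.toEquiv (G.adjMatrix ℝ) := by
    ext i j
    simp only [SimpleGraph.adjMatrix_apply, Matrix.reindex_apply, Matrix.submatrix_apply]
    exact if_congr e.symm.map_adj_iff.symm rfl rfl
  have hsG : spec G = (G.adjMatrix ℝ).charpoly.roots := by unfold spec; congr!
  have hsH : spec H = (H.adjMatrix ℝ).charpoly.roots := by unfold spec; congr!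
  rw [hsG, hsH, h, Matrix.charpoly_reindex]

/-- `G` is determined by its spectrum if and only if any two graphs on a given set with the same
spectrum as `G` are isomorphic, where the set has as many elements as there are vertices. -/
theorem isDS_iff {G : SimpleGraph V} (hc : Fintype.card V = Fintype.card W) : IsDS G ↔
    ∀ H H' : SimpleGraph W, spec G = spec H → spec G = spec H' → Nonempty (H ≃g H') := by
  constructor
  · intro h H H' h1 h2
    obtain ⟨e⟩ := h W H h1
    obtain ⟨e'⟩ := h W H' h2
    exact ⟨e.symm.trans e'⟩
  · intro h U _ K hK
    have hU : Fintype.card V = Fintype.card U := by rw [← card_spec G, hK, card_spec K]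
    let e := SimpleGraph.Iso.map (Fintype.equivOfCardEq hc) G
    let e' := SimpleGraph.Iso.map (Fintype.equivOfCardEq (hU.symm.trans hc)) K
    obtain ⟨f⟩ := h _ _ (spec_eq_of_iso e) (hK.trans (spec_eq_of_iso e'))
    exact ⟨(e.trans f).trans e'.symm⟩

end

end GraphSpectrum

namespace PFPC

open GraphSpectrum

/-! ### The sentence defining the graphs determined by their spectrum -/

variable {L : FirstOrder.Language.{0, 0}} {Γ : List Kind}

theorem adjMat_pow_le (M : Model L) {s : Srt} (R : M.D s → M.D s → Prop) (k : ℕ) (x y : M.Vtx s) :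
    (adjMat M R ^ k) x y ≤ Nat.card M.carrier ^ k := by
  induction k generalizing x with
  | zero =>
    rw [pow_zero, pow_zero, Matrix.one_apply]
    split_ifs <;> simp
  | succ k ih =>
    rw [pow_succ', pow_succ', Matrix.mul_apply, ← M.card_vtx s, Nat.card_eq_fintype_card]
    calc ∑ z, adjMat M R x z * (adjMat M R ^ k) z y
        ≤ ∑ _z : M.Vtx s, 1 * Nat.card M.carrier ^ k :=
          Finset.sum_le_sum fun z _ => Nat.mul_le_mul (by
            simp only [adjMat, Matrix.of_apply]
            split_ifs <;> simp) (ih z)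
      _ = _ := by
          rw [Finset.sum_const, Finset.card_univ, smul_eq_mul, one_mul, ← M.card_vtx s,
            Nat.card_eq_fintype_card]

/-- The numbers of closed walks are small enough to be determined by the digits at positions given
by pairs of numbers. -/
theorem trace_pow_lt (M : Model L) {s : Srt} (R : M.D s → M.D s → Prop) {k : ℕ}
    (hk : k ≤ Nat.card M.carrier) :
    (adjMat M R ^ k).trace < 2 ^ ((Nat.card M.carrier + 1) * (Nat.card M.carrier + 1)) := by
  set n := Nat.card M.carrier with hn
  have h1 : (adjMat M R ^ k).trace ≤ n * n ^ k := by
    calc (adjMat M R ^ k).trace ≤ ∑ _z : M.Vtx s, n ^ k :=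
          Finset.sum_le_sum fun z _ => adjMat_pow_le M R k z z
      _ = n * n ^ k := by
          rw [Finset.sum_const, Finset.card_univ, smul_eq_mul, ← Nat.card_eq_fintype_card,
            M.card_vtx]
  have h2 : n * n ^ k ≤ (2 ^ n) ^ (n + 1) := by
    rw [← pow_succ']
    calc n ^ (k + 1) ≤ (2 ^ n) ^ (k + 1) := Nat.pow_le_pow_left Nat.lt_two_pow_self.le _
      _ ≤ (2 ^ n) ^ (n + 1) := Nat.pow_le_pow_right (by positivity) (by omega)
  refine (h1.trans h2).trans_lt ?_
  rw [← pow_mul]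
  exact Nat.pow_lt_pow_right (by norm_num) (by nlinarith)

/-- The equality of all digits expresses the equality of the numbers of closed walks. -/
theorem trace_pow_eq_iff (M : Model L) {s s' : Srt} (R : M.D s → M.D s → Prop)
    (R' : M.D s' → M.D s' → Prop) :
    (∀ k i j : M.D Srt.num, ((adjMat M R ^ numVal k).trace.testBit (pos i j) ↔
      (adjMat M R' ^ numVal k).trace.testBit (pos i j))) ↔
    ∀ k ≤ Nat.card M.carrier, (adjMat M R ^ k).trace = (adjMat M R' ^ k).trace := by
  constructor
  · intro h k hk
    refine Nat.eq_of_testBit_eq fun p => ?_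
    by_cases hp : p < (Nat.card M.carrier + 1) * (Nat.card M.carrier + 1)
    · obtain ⟨i, j, rfl⟩ := exists_pos hp
      obtain ⟨k, rfl⟩ := exists_numVal hk
      exact Bool.eq_iff_iff.2 (h k i j)
    · have h2 : 2 ^ ((Nat.card M.carrier + 1) * (Nat.card M.carrier + 1)) ≤ 2 ^ p :=
        Nat.pow_le_pow_right (by norm_num) (not_lt.1 hp)
      rw [Nat.testBit_lt_two_pow ((trace_pow_lt M R hk).trans_le h2),
        Nat.testBit_lt_two_pow ((trace_pow_lt M R' hk).trans_le h2)]
  · intro h k i j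
    rw [h _ (numVal_le_card k)]

/-- Adjacency in the graph on the number domain encoded by a binary relation. -/
def NumAdj {V : Type} (S : Set (Tuple V numNum)) (x y : Dom V Srt.num) : Prop :=
  x ≠ y ∧ Tuple.mk2 x y ∈ S ∧ Tuple.mk2 y x ∈ S

/-- The graph on the numbers less than the size of the structure encoded by a binary relation. -/
def numGraph (M : Model L) (S : Set (Tuple M.carrier numNum)) : SimpleGraph (M.Vtx Srt.num) where
  Adj x y := NumAdj S x.val y.val
  symm := ⟨fun _ _ h => ⟨h.1.symm, h.2.2, h.2.1⟩⟩
  loopless := ⟨fun _ h => h.1 rfl⟩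

theorem exists_numGraph_eq (M : Model L) (H : SimpleGraph (M.Vtx Srt.num)) :
    ∃ S, numGraph M S = H := by
  refine ⟨{t | ∃ x y, H.Adj x y ∧ t = Tuple.mk2 x.val y.val}, ?_⟩
  have hmk : ∀ {x y x' y' : M.Vtx Srt.num}, Tuple.mk2 x.val y.val = Tuple.mk2 x'.val y'.val →
      x = x' ∧ y = y' := fun h =>
    ⟨Model.Vtx.ext (congrArg (fun t => t.1) h), Model.Vtx.ext (congrArg (fun t => t.2.1) h)⟩
  ext x y
  constructor
  · rintro ⟨-, ⟨x', y', h, h'⟩, -⟩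
    obtain ⟨rfl, rfl⟩ := hmk h'
    exact h
  · intro h
    exact ⟨fun h' => h.ne (Model.Vtx.ext h'), ⟨x, y, h, rfl⟩, ⟨y, x, h.symm, rfl⟩⟩

theorem DefR₂.numAdj {S : ∀ M : Model L, M.Env Γ → Set (Tuple M.carrier numNum)}
    (hS : IsRelVar Γ S) : DefR₂ Γ fun M e => NumAdj (S M e) := fun _ f _ _ ht hu =>
  .and (DefP.eq ht hu).neg (.and (.mem (.mk2 ht hu) (hS.ext f)) (.mem (.mk2 hu ht) (hS.ext f)))

/-- The graph encoded by `S` has the same number of closed walks of each length up to the size of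
the structure as the relation `R` on the structure; the numbers are compared digit by digit. -/
def SameWalks (M : Model L) (R : M.D Srt.elem → M.D Srt.elem → Prop)
    (S : Set (Tuple M.carrier numNum)) : Prop :=
  ∀ k i j : M.D Srt.num, ((adjMat M R ^ numVal k).trace.testBit (pos i j) ↔
    (adjMat M (NumAdj S) ^ numVal k).trace.testBit (pos i j))

theorem DefP.sameWalks {R : ∀ M : Model L, M.Env Γ → M.D Srt.elem → M.D Srt.elem → Prop}
    (hR : DefR₂ Γ R) {S : ∀ M : Model L, M.Env Γ → Set (Tuple M.carrier numNum)}
    (hS : IsRelVar Γ S) : DefP Γ fun M e => SameWalks M (R M e) (S M e) :=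
  .all (.all (.all (.iff
    (.testBit_trace_pow (Γ := .fo .num :: .fo .num :: .fo .num :: Γ) (R := fun M e => R M e.2.2.2)
      (fun Δ f => hR Δ (.comp (.cons _ (.cons _ (.cons _ (.refl Γ)))) f)) .v2 .v1 .v0)
    (.testBit_trace_pow (Γ := .fo .num :: .fo .num :: .fo .num :: Γ) (R := fun M e => NumAdj (S M e.2.2.2)) (.numAdj hS.weak.weak.weak)
      .v2 .v1 .v0))))

/-- The binary relation `P` on the number domain is an isomorphism between the graphs encoded by
`S` and `S'`. -/
def IsIsoRel {V : Type} (P S S' : Set (Tuple V numNum)) : Prop :=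
  (∀ x : Dom V Srt.num, IsVtx x → ∃ y : Dom V Srt.num, IsVtx y ∧ Tuple.mk2 x y ∈ P) ∧
  ∀ x y x' y' : Dom V Srt.num, IsVtx x ∧ IsVtx y ∧ IsVtx x' ∧ IsVtx y' ∧ Tuple.mk2 x y ∈ P ∧
    Tuple.mk2 x' y' ∈ P → (x = x' ↔ y = y') ∧ (NumAdj S x x' ↔ NumAdj S' y y')

theorem DefP.isIsoRel {P S S' : ∀ M : Model L, M.Env Γ → Set (Tuple M.carrier numNum)}
    (hP : IsRelVar Γ P) (hS : IsRelVar Γ S) (hS' : IsRelVar Γ S') :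
    DefP Γ fun M e => IsIsoRel (P M e) (S M e) (S' M e) :=
  .and (.all (.imp (.isVtx .v0) (.ex (.and (.isVtx .v0) (.mem (.mk2 .v1 .v0) hP.weak.weak)))))
    (.all (.all (.all (.all (.imp (.and (.isVtx .v3) (.and (.isVtx .v2) (.and (.isVtx .v1)
      (.and (.isVtx .v0) (.and (.mem (.mk2 .v3 .v2) hP.weak.weak.weak.weak)
        (.mem (.mk2 .v1 .v0) hP.weak.weak.weak.weak))))))
      (.and (.iff (.eq .v3 .v1) (.eq .v2 .v0))
        (.iff (DefR₂.numAdj hS.weak.weak.weak.weak _ (.refl _) _ _ .v3 .v1)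
          (DefR₂.numAdj hS'.weak.weak.weak.weak _ (.refl _) _ _ .v2 .v0))))))))

/-- Injectivity of the map given by `P` suffices, as the number of vertices is finite. -/
theorem exists_isIsoRel_iff (M : Model L) (S S' : Set (Tuple M.carrier numNum)) :
    (∃ P, IsIsoRel P S S') ↔ Nonempty (numGraph M S ≃g numGraph M S') := by
  constructor
  · rintro ⟨P, hP, hP'⟩
    choose f hf hfP using fun x : M.Vtx Srt.num => hP x.val x.isVtx
    have h := fun x x' : M.Vtx Srt.num => hP' x.val (f x) x'.val (f x')
      ⟨x.isVtx, hf x, x'.isVtx, hf x', hfP x, hfP x'⟩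
    have hinj : Function.Injective fun x => (⟨f x, hf x⟩ : M.Vtx Srt.num) := fun x x' hx =>
      Model.Vtx.ext ((h x x').1.2 (congrArg Model.Vtx.val hx))
    exact ⟨⟨Equiv.ofBijective _ (Finite.injective_iff_bijective.1 hinj), (h _ _).2.symm⟩⟩
  · rintro ⟨e⟩
    refine ⟨{t | ∃ x : M.Vtx Srt.num, t = Tuple.mk2 x.val (e x).val},
      fun x hx => ⟨(e ⟨x, hx⟩).val, (e ⟨x, hx⟩).isVtx, ⟨x, hx⟩, rfl⟩, ?_⟩
    rintro x y x' y' ⟨hx, hy, hx', hy', ⟨z, hz⟩, ⟨z', hz'⟩⟩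
    obtain rfl : x = z.val := congrArg (fun t => t.1) hz
    obtain rfl : y = (e z).val := congrArg (fun t => t.2.1) hz
    obtain rfl : x' = z'.val := congrArg (fun t => t.1) hz'
    obtain rfl : y' = (e z').val := congrArg (fun t => t.2.1) hz'
    refine ⟨?_, e.map_adj_iff.symm⟩
    rw [← Model.Vtx.ext_iff, ← Model.Vtx.ext_iff, e.injective.eq_iff]

/-- Adjacency in a structure for the language of graphs. -/
def ElemAdj (M : Model FirstOrder.Language.graph) (x y : M.D Srt.elem) : Prop :=
  FirstOrder.Language.Structure.RelMap (M := M.carrier) FirstOrder.Language.adj ![x, y]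

/-- Any two graphs on the numbers with the same numbers of closed walks as the structure are
isomorphic. -/
def DSProp (M : Model FirstOrder.Language.graph) : Prop :=
  ∀ S S' : Set (Tuple M.carrier numNum),
    SameWalks M (ElemAdj M) S → SameWalks M (ElemAdj M) S' → ∃ P, IsIsoRel P S S'

theorem defP_dsProp : DefP [] fun M _ => DSProp M := by
  have hadj : ∀ Γ : List Kind, DefR₂ Γ fun (M : Model FirstOrder.Language.graph) _ => ElemAdj M :=
    fun _ _ _ _ _ ht hu => DefP.relMap₂ ht hu
  exact .allRel (.allRel (.imp (.sameWalks (hadj _) IsRelVar.v0.weak) (.imp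
    (.sameWalks (hadj _) IsRelVar.v0) (.exRel (.isIsoRel .v0 IsRelVar.v0.weak.weak
      IsRelVar.v0.weak)))))

theorem dsProp_iff {V : Type} [Fintype V] (G : SimpleGraph V) :
    DSProp (Model.mk V (str := G.structure)) ↔ IsDS G := by
  classical
  set M : Model FirstOrder.Language.graph := Model.mk V (str := G.structure) with hM
  let K : SimpleGraph (M.Vtx Srt.elem) := G.comap M.vtxElem
  have e : K ≃g G := ⟨M.vtxElem, Iff.rfl⟩
  have hcard : ∀ s, Fintype.card (M.Vtx s) = Nat.card V := fun s => by
    rw [← Nat.card_eq_fintype_card, M.card_vtx]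
  have hwalks : ∀ S, SameWalks M (ElemAdj M) S ↔ spec G = spec (numGraph M S) := by
    intro S
    rw [SameWalks, trace_pow_eq_iff, ← spec_eq_of_iso e,
      spec_eq_spec_iff K _ ((hcard _).trans (hcard _).symm), hcard]
    have h1 : adjMat M (ElemAdj M) = K.adjMatrix ℕ := by
      ext x y
      simp only [adjMat, Matrix.of_apply, SimpleGraph.adjMatrix_apply]
      exact if_congr Iff.rfl rfl rfl
    have h2 : adjMat M (NumAdj S) = (numGraph M S).adjMatrix ℕ := by
      ext x y
      simp only [adjMat, Matrix.of_apply, SimpleGraph.adjMatrix_apply]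
      exact if_congr Iff.rfl rfl rfl
    rw [h1, h2]
  rw [isDS_iff (W := M.Vtx Srt.num) (by rw [hcard, Nat.card_eq_fintype_card])]
  simp only [DSProp, hwalks, exists_isIsoRel_iff]
  constructor
  · intro h H H'
    obtain ⟨S, rfl⟩ := exists_numGraph_eq M H
    obtain ⟨S', rfl⟩ := exists_numGraph_eq M H'
    exact h S S'
  · exact fun h S S' => h _ _

theorem exists_sentence_isDS : ∃ φ : Formula FirstOrder.Language.graph, φ.IsSentence ∧
    ∀ (V : Type) [Fintype V] [Nonempty V] (G : SimpleGraph V), Models G φ ↔ IsDS G := by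
  obtain ⟨φ, hφ, h⟩ := defP_dsProp
  refine ⟨φ, Finset.subset_empty.1 hφ, fun V _ _ G => ?_⟩
  rw [← dsProp_iff]
  have hM := h (Model.mk V (str := G.structure))
  constructor
  · intro hG
    obtain ⟨v⟩ := ‹Nonempty V›
    let ρ : Assignment V := ⟨fun | (.elem, _) => v | (.num, _) => (0 : Fin (Nat.card V + 1)),
      fun _ => ∅⟩
    exact (hM ρ).1 (hG ρ)
  · exact fun hG ρ => (hM ρ).2 hG

end PFPC

theorem mainTheorem2 :
    -- the class of graphs determined by their spectrum is definable by a sentence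
    (∃ φ : PFPC.Formula FirstOrder.Language.graph, φ.IsSentence ∧
      ∀ (V : Type) [Fintype V] [Nonempty V] (G : SimpleGraph V),
        PFPC.Models G φ ↔ GraphSpectrum.IsDS G) ∧
    -- quantification over binary relations on the number domain is expressible
    (∀ (L : FirstOrder.Language.{0, 0}) (θ : PFPC.Formula L) (R : ℕ),
      ∃ ψ : PFPC.Formula L,
        ψ.fv ⊆ θ.fv \ {Sum.inr ([PFPC.Srt.num, PFPC.Srt.num], R)} ∧
        ∀ (V : Type) [L.Structure V] [Finite V] (ρ : PFPC.Assignment V),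
          ψ.Sat ρ ↔ ∀ S : Set (PFPC.Tuple V [PFPC.Srt.num, PFPC.Srt.num]),
            θ.Sat (ρ.setRel ([PFPC.Srt.num, PFPC.Srt.num], R) S)) :=
  ⟨PFPC.exists_sentence_isDS, PFPC.exists_allNumRel⟩
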